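/- Let $(\lambda_n)_{n\ge1}$ and $(\mu_n)_{n\ge1}$ be strictly increasing sequences of positive real numbers tending to $\infty$, let $(a_n),(b_n)$ be sequences of complex numbers, and suppose that the Dirichlet series $\phi(s)=\sum_{n\ge1}a_n\lambda_n^{-s}$ and $\psi(s)=\sum_{n\ge1}b_n\mu_n^{-s}$ have finite abscissae of absolute convergence $\sigma_a$ and $\sigma_b$ respectively. Let $r\ge1$, $\alpha_i>0$, $\beta_i\in\mathbb C$ with $\Re(\beta_i)\ge0$ $(1\le i\le r)$, $Q>0$, $\delta>0$ and $\omega\in\mathbb C$ with $|\omega|=1$, and put $$F(s)=\phi(s)\prod_{i=1}^r\Gamma(\alpha_is+\beta_i),\qquad G(s)=\psi(s)\prod_{i=1}^r\Gamma(\alpha_is+\beta_i).$$ Suppose that the functional equation $$Q^sF(s)=\omega Q^{\delta-s}\,\overline{G(\delta-\bar s)}$$ holds in the following sense: there are a compact set $S\subset\mathbb C$ whose complement $D=\mathbb C\setminus S$ is connected and an analytic function $\chi$ on $D$ such that (i) for $s\in D$, $\chi(s)=Q^sF(s)$ if $\Re(s)>\sigma_a$, and $\chi(s)=\omega Q^{\delta-s}\,\overline{G(\delta-\bar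 s)}$ if $\Re(s)<\delta-\sigma_b$ (at poles of the Gamma factors, in the sense of limits); (ii) there is a constant $\theta<1$ such that for all real $\sigma_1<\sigma_2$, $$\chi(s)=O\left(\exp\left[\exp\left(\frac{\theta\pi|s|}{\sigma_2-\sigma_1}\right)\right]\right)\qquad\text{as } |s|\to\infty,\ \text{uniformly in } \sigma_1\le\Re(s)\le\sigma_2.$$ Denote by $F(s)=Q^{-s}\chi(s)$ also the continuation of $F$ to $D$. Let $C\subset D$ be a (positively oriented) circle of finite positive radius that contains all the singularities of $F$ in its interior; that is, $F$ extends analytically to the whole exterior of $C$. Put $$P(x)=\frac1{2\pi i}\int_CF(s)x^{-s}\,ds\qquad(x>0),$$ and, for a real number $a>0$ and $\boldsymbol\alpha=(\alpha_1,\dots,\alpha_r)$, $\boldsymbol\beta=(\beta_1,\dots,\beta_r)$, $\boldsymbol{\bar\beta}=(\bar\beta_1,\dots,\bar\beta_r)$, $$Z_{\boldsymbol\alpha,\boldsymbol\beta}(x)=\frac1{2\pi i}\int_{a-i\infty}^{a+i\infty}\prod_{i=1}^r\Gamma(\alpha_is+\beta_i)\,x^{-s}\,ds\qquad(x>0).$$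 Then, for every $a>0$, the integrals defining $Z_{\boldsymbol\alpha,\boldsymbol\beta}(x)$ and $Z_{\boldsymbol\alpha,\boldsymbol{\bar\beta}}(x)$ converge absolutely for all $x>0$, and for all $x>0$ the modular relation $$\sum_{n=1}^\infty a_nZ_{\boldsymbol\alpha,\boldsymbol\beta}(\lambda_nx)=P(x)+\frac{\omega}{(xQ)^\delta}\sum_{n=1}^\infty\overline{b_n}\,Z_{\boldsymbol\alpha,\boldsymbol{\bar\beta}}\left(\frac{\mu_n}{Q^2x}\right)$$ holds, both series converging absolutely. Moreover, $P$ is a residual function with respect to $D$: it is differentiable on $(0,\infty)$; for some $c>0$, $P(x)=O(x^{-c})$ as $x\to0^+$ and $P(x)=O(x^c)$ as $x\to\infty$; the functions $I_1(s)=\int_0^1P(x)x^{s-1}\,dx$ and $I_2(s)=-\int_1^\infty P(x)x^{s-1}\,dx$, which are defined by absolutely convergent integrals in some right half-plane and in some left half-plane respectively, have a common analytic continuation $I$ to $D$; and $I(\sigma+it)\to0$ as $|t|\to\infty$, uniformly in $\sigma_1\le\sigma\le\sigma_2$ for all real $\sigma_1\le\sigma_2$. -/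

import Mathlib

open Complex Filter Topology Asymptotics Set MeasureTheory

noncomputable section

/-- The generalized Dirichlet series `∑ c n / (ν n) ^ s`. -/
def dirichletSeries (c : ℕ → ℂ) (ν : ℕ → ℝ) (s : ℂ) : ℂ :=
  ∑' n, c n / (ν n : ℂ) ^ s

/-- The abscissa of absolute convergence of `∑ c n / (ν n) ^ s`, an extended real number. -/
def abscissaAbs (c : ℕ → ℂ) (ν : ℕ → ℝ) : EReal :=
  sInf ((fun x : ℝ => (x : EReal)) '' {x : ℝ | Summable fun n => ‖c n‖ / ν n ^ x})

/-- `∑ c n / (ν n) ^ s` is a Dirichlet series with positive frequencies strictly increasing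
to infinity and with finite abscissa of absolute convergence `σ`.
(Finiteness excludes `c = 0`, whose abscissa is `⊥`.) -/
structure IsDirichletSeries (c : ℕ → ℂ) (ν : ℕ → ℝ) (σ : ℝ) : Prop where
  pos : ∀ n, 0 < ν n
  strictMono : StrictMono ν
  tendsto : Tendsto ν atTop atTop
  abscissa : abscissaAbs c ν = (σ : EReal)

/-- The product of Gamma factors `∏ Γ(α i * s + β i)`. -/
def gammaFactor {r : ℕ} (α : Fin r → ℝ) (β : Fin r → ℂ) (s : ℂ) : ℂ :=
  ∏ i, Complex.Gamma (α i * s + β i)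

/-- `s` is a pole of one of the factors `Γ(α i * s + β i)`. -/
def IsGammaPole {r : ℕ} (α : Fin r → ℝ) (β : Fin r → ℂ) (s : ℂ) : Prop :=
  ∃ (i : Fin r) (m : ℕ), (α i : ℂ) * s + β i = -(m : ℂ)

/-- The completed series `(∑ c n / (ν n) ^ s) * ∏ Γ(α i * s + β i)`, on the half-plane of
absolute convergence of the series. -/
def completedSeries {r : ℕ} (c : ℕ → ℂ) (ν : ℕ → ℝ) (α : Fin r → ℝ) (β : Fin r → ℂ)
    (s : ℂ) : ℂ :=
  dirichletSeries c ν s * gammaFactor α β s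

/-- The functional equation `Q ^ s F(s) = ω Q ^ (δ - s) conj (G (δ - conj s))`:
the domain `D = Sᶜ` is the exterior of a compact set `S`, and `χ` is analytic in `D`, is equal
to the left side for `Re s > σa`, to the right side for `Re s < δ - σb`, and has at most
double exponential growth at infinity in vertical strips.
The two identities are required off the poles of the Gamma factors (where Mathlib's `Gamma` has
the conventional value `0`); at a pole that lies in `D`, they hold in the limit. -/
structure FunctionalEquation {r : ℕ} (a : ℕ → ℂ) (lam : ℕ → ℝ) (σa : ℝ)
    (b : ℕ → ℂ) (mu : ℕ → ℝ) (σb : ℝ) (α : Fin r → ℝ) (β : Fin r → ℂ)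
    (Q δ : ℝ) (ω : ℂ) (S : Set ℂ) (χ : ℂ → ℂ) : Prop where
  isCompact : IsCompact S
  isConnected : IsConnected Sᶜ
  analytic : AnalyticOnNhd ℂ χ Sᶜ
  eq_right : ∀ s ∈ Sᶜ, σa < s.re → ¬ IsGammaPole α β s →
    χ s = (Q : ℂ) ^ s * completedSeries a lam α β s
  eq_left : ∀ s ∈ Sᶜ, s.re < δ - σb → ¬ IsGammaPole α β (δ - (starRingEnd ℂ) s) →
    χ s = ω * (Q : ℂ) ^ ((δ : ℂ) - s) *
      (starRingEnd ℂ) (completedSeries b mu α β (δ - (starRingEnd ℂ) s))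
  growth : ∃ θ : ℝ, θ < 1 ∧ ∀ σ₁ σ₂ : ℝ, σ₁ < σ₂ →
    χ =O[Bornology.cobounded ℂ ⊓ 𝓟 {s : ℂ | σ₁ ≤ s.re ∧ s.re ≤ σ₂}]
      fun s => Real.exp (Real.exp (θ * Real.pi * ‖s‖ / (σ₂ - σ₁)))

/-- The analytic continuation `Q ^ (-s) * χ s` of the completed series `F` to the domain `D`
on which `χ` is analytic. -/
def continuedF (Q : ℝ) (χ : ℂ → ℂ) (s : ℂ) : ℂ :=
  (Q : ℂ) ^ (-s) * χ s

/-- The circle with centre `c` and radius `R > 0` lies in `Sᶜ`, and all the singularities of `F`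
(an analytic function on `Sᶜ`) lie inside it, i.e. `F` extends analytically to the whole
exterior of the circle. This holds in particular if the open disc contains `S`. -/
def CircleEnclosesSingularities (S : Set ℂ) (F : ℂ → ℂ) (c : ℂ) (R : ℝ) : Prop :=
  0 < R ∧ Metric.sphere c R ⊆ Sᶜ ∧
    ∃ g : ℂ → ℂ, AnalyticOnNhd ℂ g (Sᶜ ∪ (Metric.closedBall c R)ᶜ) ∧ EqOn g F Sᶜ

/-- `Z(x) = (1 / 2πi) ∫ ∏ Γ(α i * s + β i) x ^ (-s) ds` over the line `Re s = κ`. -/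
def zFun {r : ℕ} (α : Fin r → ℝ) (β : Fin r → ℂ) (κ : ℝ) (x : ℝ) : ℂ :=
  mellinInv κ (gammaFactor α β) x

/-- `P(x) = (1 / 2πi) ∮ F(s) x ^ (-s) ds` over the circle with centre `c` and radius `R`. -/
def residualIntegral (F : ℂ → ℂ) (c : ℂ) (R : ℝ) (x : ℝ) : ℂ :=
  (2 * Real.pi * I : ℂ)⁻¹ * ∮ s in C(c, R), F s * (x : ℂ) ^ (-s)

/-- Residual functions in the sense of Bochner, with respect to the domain `Sᶜ`. -/
structure IsResidualFunction (S : Set ℂ) (P : ℝ → ℂ) : Prop where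
  differentiable : DifferentiableOn ℝ P (Ioi 0)
  growth : ∃ c : ℝ, 0 < c ∧ P =O[𝓝[>] (0 : ℝ)] (fun x => x ^ (-c)) ∧
    P =O[atTop] (fun x => x ^ c)
  continuation : ∃ J : ℂ → ℂ, AnalyticOnNhd ℂ J Sᶜ ∧
    (∃ c : ℝ, ∀ s : ℂ, c < s.re →
      IntegrableOn (fun x : ℝ => P x * (x : ℂ) ^ (s - 1)) (Ioc 0 1) ∧
      J s = ∫ x in Ioc (0 : ℝ) 1, P x * (x : ℂ) ^ (s - 1)) ∧
    (∃ c : ℝ, ∀ s : ℂ, s.re < c →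
      IntegrableOn (fun x : ℝ => P x * (x : ℂ) ^ (s - 1)) (Ioi 1) ∧
      J s = -∫ x in Ioi (1 : ℝ), P x * (x : ℂ) ^ (s - 1)) ∧
    ∀ σ₁ σ₂ : ℝ, σ₁ ≤ σ₂ →
      Tendsto J (Bornology.cobounded ℂ ⊓ 𝓟 {s : ℂ | σ₁ ≤ s.re ∧ s.re ≤ σ₂}) (𝓝 0)

end

/-! For large `κ`, exchanging sum and integral turns `∑ a n * Z(lam n * x)` into the inverse Mellin
transform of `F` on `Re s = κ`. Moving the line to `Re s = -κ` crosses all the singularities and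
produces the integral over the circle, which is `P x`. On the new line the functional equation and
the substitution `s ↦ δ - s` give the inverse Mellin transform of the conjugate series, hence the
second sum. This is `FunctionalEquation.mellinInv_eq`.

The singularities need not be isolated, so no residue calculus applies. Instead a function `g`
analytic outside the disc is split as `E + H`, with `E` entire and `H` the Cauchy integral of `g`
over the circle, which decays at infinity (`exists_entire_add_principalPart`,
`norm_principalPart_le`). Over a rectangle around the circle, `E` integrates to zero, and Fubini
with the winding number of the rectangle handles `H` (`rectIntegral_eq_circleIntegral`).

The horizontal sides vanish in the limit because `F` decays quadratically in the strip. On the two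
edges this follows from `|z|^N |Γ(z)| ≤ Γ(Re z + N)`, without Stirling's formula. Phragmén–Lindelöf,
applied to the entire part of `(s - c)^2 F(s)`, carries it inside; the condition `θ < 1` is what
that principle requires.

The same splitting shows that `P` is residual: since `∫₀¹ x^(s-w-1) dx = 1/(s-w)`, both Mellin
integrals of `P` equal `H` far out, and `F - E` continues `H` to all of `Sᶜ`. -/

/-! ### Laurent-type splitting outside a disc. -/

/-- The principal part of a function analytic outside a disc: its Cauchy integral
over the boundary circle, evaluated outside the disc. -/
noncomputable def principalPart (g : ℂ → ℂ) (c : ℂ) (R : ℝ) (s : ℂ) : ℂ :=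
  (2 * Real.pi * I : ℂ)⁻¹ * ∮ w in C(c, R), (s - w)⁻¹ * g w

/-- The pole `s` lies inside the smaller circle, so the integrand is holomorphic on the annulus.
This lets the entire part be defined by circles whose radius varies with the point. -/
theorem circleIntegral_inv_sub_mul_congr_radius {g : ℂ → ℂ} {c : ℂ} {R : ℝ} (hR : 0 < R)
    (hg : ∀ z, R ≤ dist z c → DifferentiableAt ℂ g z) {ρ₁ ρ₂ : ℝ} (h₁ : R ≤ ρ₁) (h₂ : ρ₁ ≤ ρ₂)
    {s : ℂ} (hs : dist s c < ρ₁) :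
    (∮ z in C(c, ρ₂), (z - s)⁻¹ • g z) = ∮ z in C(c, ρ₁), (z - s)⁻¹ • g z := by
  have key : ∀ z, ρ₁ ≤ dist z c → DifferentiableAt ℂ (fun z => (z - s)⁻¹ • g z) z := by
    intro z hz
    have hne : z - s ≠ 0 := by
      rw [sub_ne_zero]; rintro rfl; linarith
    exact ((differentiableAt_id.sub_const s).inv hne).smul (hg z (h₁.trans hz))
  refine circleIntegral_eq_of_differentiable_on_annulus_off_countable (by linarith) h₂
    countable_empty (fun z hz => ?_) (fun z hz => ?_)
  · exact (key z (by simpa using hz.2)).continuousAt.continuousWithinAt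
  · exact key z (by simpa using (not_le.1 hz.1.2).le)

/-- A function analytic outside an open disc is the sum of an entire function and its principal
part. -/
theorem exists_entire_add_principalPart {g : ℂ → ℂ} {c : ℂ} {R : ℝ} (hR : 0 < R)
    (hg : ∀ z, R ≤ dist z c → DifferentiableAt ℂ g z) :
    ∃ E : ℂ → ℂ, Differentiable ℂ E ∧
      ∀ s, R < dist s c → g s = E s + principalPart g c R s := by
  set K : ℝ → ℂ → ℂ := fun ρ s => (2 * Real.pi * I : ℂ)⁻¹ • ∮ z in C(c, ρ), (z - s)⁻¹ • g z
    with hK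
  have hcont : ∀ ρ, R ≤ ρ → ContinuousOn g (Metric.sphere c ρ) := fun ρ hρ z hz =>
    (hg z (by rw [Metric.mem_sphere.1 hz]; exact hρ)).continuousAt.continuousWithinAt
  have hKd : ∀ ρ, R ≤ ρ → ∀ s, dist s c < ρ → DifferentiableAt ℂ (K ρ) s := by
    intro ρ hρ s hs
    have hρ0 : 0 < ρ := hR.trans_le hρ
    lift ρ to NNReal using hρ0.le
    have := hasFPowerSeriesOn_cauchy_integral
      ((hcont ρ hρ).circleIntegrable hρ0.le) (by exact_mod_cast hρ0)
    exact this.differentiableOn.differentiableAt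
      (Metric.isOpen_eball.mem_nhds (by
        rw [Metric.mem_eball, edist_dist, ← ENNReal.ofReal_coe_nnreal]
        exact (ENNReal.ofReal_lt_ofReal_iff hρ0).2 hs))
  -- The radius exceeds `dist s c` because `R > 0`. Near any `s₀` it may be replaced by one fixed
  -- larger radius, whence differentiability.
  refine ⟨fun s => K (R + dist s c) s, fun s₀ => ?_, fun s hs => ?_⟩
  · have h1 := hKd (R + dist s₀ c + 1) (by linarith [dist_nonneg (x := s₀) (y := c)]) s₀
      (by linarith)
    refine h1.congr_of_eventuallyEq ?_
    filter_upwards [Metric.ball_mem_nhds s₀ one_pos] with s hs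
    have h2 : dist s c ≤ dist s₀ c + 1 := by
      have := dist_triangle s s₀ c
      have := Metric.mem_ball.1 hs
      linarith
    simp only [hK]
    rw [circleIntegral_inv_sub_mul_congr_radius hR hg
      (ρ₁ := R + dist s c) (ρ₂ := R + dist s₀ c + 1) (by linarith [dist_nonneg (x := s) (y := c)])
      (by linarith) (by linarith)]
  · have hρ : R ≤ R + dist s c := by linarith [dist_nonneg (x := s) (y := c)]
    have hρ0 : 0 ≤ R + dist s c := by linarith
    have hsd : DifferentiableAt ℂ g s := hg s hs.le
    -- Cauchy's formula on the annulus: `dslope` removes the singularity at `s`, so its integrals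
    -- over the two circles agree. Splitting off `g s * (z - s)⁻¹` then gives `2πi * g s` on the
    -- outer circle and zero on the inner one.
    have e1 : (∮ z in C(c, R + dist s c), dslope g s z) = ∮ z in C(c, R), dslope g s z := by
      refine circleIntegral_eq_of_differentiable_on_annulus_off_countable hR hρ
        (countable_singleton s) (fun z hz => ?_) (fun z hz => ?_)
      · apply ContinuousAt.continuousWithinAt
        by_cases h : z = s
        · subst h; exact continuousAt_dslope_same.2 hsd
        · exact (continuousAt_dslope_of_ne h).2 (hg z (by simpa using hz.2)).continuousAt
      · exact (differentiableAt_dslope_of_ne (by simpa using hz.2)).2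
          (hg z (by simpa using (not_le.1 hz.1.2).le))
    have e2 : ∀ ρ, R ≤ ρ → ρ ≠ dist s c → (∮ z in C(c, ρ), dslope g s z) =
        (∮ z in C(c, ρ), (z - s)⁻¹ • g z) - (∮ z in C(c, ρ), (z - s)⁻¹) * g s := by
      intro ρ hρ hne
      have hns : ∀ z ∈ Metric.sphere c ρ, z - s ≠ 0 := by
        intro z hz
        rw [sub_ne_zero]; rintro rfl; exact hne (Metric.mem_sphere.1 hz).symm
      have hi : ContinuousOn (fun z : ℂ => (z - s)⁻¹) (Metric.sphere c ρ) :=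
        (continuousOn_id.sub continuousOn_const).inv₀ hns
      have hρ0 : 0 ≤ ρ := hR.le.trans hρ
      have i1 : CircleIntegrable (fun z => (z - s)⁻¹ • g z) c ρ :=
        (hi.smul (hcont ρ hρ)).circleIntegrable hρ0
      have i2 : CircleIntegrable (fun z => g s * (z - s)⁻¹) c ρ :=
        (continuousOn_const.mul hi).circleIntegrable hρ0
      rw [mul_comm, ← circleIntegral.integral_const_mul, ← circleIntegral.integral_sub i1 i2]
      refine circleIntegral.integral_congr hρ0 fun z hz => ?_
      rw [dslope_of_ne _ (by simpa [sub_eq_zero] using hns z hz), slope_def_field]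
      simp only [smul_eq_mul]
      ring
    have e3 : (∮ z in C(c, R), (z - s)⁻¹) = 0 := by
      have key : ∀ z, dist z c ≤ R → DifferentiableAt ℂ (fun z => (z - s)⁻¹) z := by
        intro z hz
        refine (differentiableAt_id.sub_const s).inv ?_
        simp only [id]
        rw [sub_ne_zero]; rintro rfl; linarith
      exact circleIntegral_eq_zero_of_differentiable_on_off_countable hR.le countable_empty
        (fun z hz => (key z (by simpa using hz)).continuousAt.continuousWithinAt)
        (fun z hz => key z (by simpa using (Metric.mem_ball.1 hz.1).le))
    have e4 : (∮ z in C(c, R + dist s c), (z - s)⁻¹) = 2 * Real.pi * I :=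
      circleIntegral.integral_sub_inv_of_mem_ball (by simpa using hR)
    rw [e2 _ hρ (by linarith), e2 R le_rfl hs.ne, e3, e4] at e1
    have e5 : (∮ w in C(c, R), (s - w)⁻¹ * g w) = - ∮ z in C(c, R), (z - s)⁻¹ • g z := by
      rw [← neg_one_mul, ← circleIntegral.integral_const_mul]
      refine circleIntegral.integral_congr hR.le fun z hz => ?_
      simp only [smul_eq_mul]
      rw [← neg_sub z s, inv_neg]; ring
    simp only [hK, principalPart, e5, smul_eq_mul] at e1 ⊢
    have hpi : (2 * Real.pi * I : ℂ) ≠ 0 := two_pi_I_ne_zero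
    linear_combination (-(2 * Real.pi * I : ℂ)⁻¹) * e1 - g s * inv_mul_cancel₀ hpi

/-- The principal part decays at infinity. -/
theorem norm_principalPart_le {g : ℂ → ℂ} {c : ℂ} {R : ℝ} (hR : 0 < R)
    (hg : ContinuousOn g (Metric.sphere c R)) :
    ∃ M, 0 ≤ M ∧ ∀ s, R < dist s c → ‖principalPart g c R s‖ ≤ M / (dist s c - R) := by
  obtain ⟨M, hM⟩ := (isCompact_sphere c R).exists_bound_of_continuousOn hg
  refine ⟨R * |M|, by positivity, fun s hs => ?_⟩
  have := circleIntegral.norm_two_pi_i_inv_smul_integral_le_of_norm_le_const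
    (f := fun w => (s - w)⁻¹ * g w) (c := c) (C := |M| / (dist s c - R)) hR.le ?_
  · rw [mul_div_assoc]; exact this
  · intro w hw
    have h1 : dist s c - R ≤ ‖s - w‖ := by
      rw [← dist_eq_norm]
      have := dist_triangle s w c
      rw [Metric.mem_sphere.1 hw] at this
      linarith
    have h2 : 0 < dist s c - R := by linarith
    rw [norm_mul, norm_inv, div_eq_mul_inv, mul_comm]
    gcongr
    exact (hM w hw).trans (le_abs_self M)

/-! ### Contour integrals over rectangles. -/

/-- The integral over the boundary of the rectangle `[a, b] × [-T, T]`. -/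
noncomputable def rectIntegral (f : ℂ → ℂ) (a b T : ℝ) : ℂ :=
  (∫ x : ℝ in a..b, f (x + (-T : ℝ) * I)) - (∫ x : ℝ in a..b, f (x + T * I)) +
    I * (∫ y : ℝ in (-T)..T, f (b + y * I)) - I * ∫ y : ℝ in (-T)..T, f (a + y * I)

theorem rectIntegral_eq_zero {f : ℂ → ℂ} {a b T : ℝ} (hab : a ≤ b)
    (hf : ∀ z : ℂ, a ≤ z.re → z.re ≤ b → DifferentiableAt ℂ f z) :
    rectIntegral f a b T = 0 := by
  have := integral_boundary_rect_eq_zero_of_differentiableOn f ⟨a, -T⟩ ⟨b, T⟩ (by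
    intro z hz
    rw [mem_reProdIm] at hz
    simp only at hz
    rw [uIcc_of_le hab] at hz
    exact (hf z hz.1.1 hz.1.2).differentiableWithinAt)
  simpa [rectIntegral] using this

/-- A primitive of the integrand is a logarithm; the constant `e` rotates the segment away from the
branch cut. For a rectangle `e = 1` serves on three sides and `e = -1` on the left one. -/
theorem integral_inv_segment {v w u e : ℂ} (he : e ≠ 0) {p q : ℝ} (hpq : p ≤ q)
    (h : ∀ t : ℝ, p ≤ t → t ≤ q → e * (v + t * u - w) ∈ slitPlane) :
    u * ∫ t : ℝ in p..q, (v + t * u - w)⁻¹ =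
      log (e * (v + q * u - w)) - log (e * (v + p * u - w)) := by
  rw [← intervalIntegral.integral_const_mul]
  have hd : ∀ t : ℝ, HasDerivAt (fun t : ℝ => e * (v + t * u - w)) (e * u) t := by
    intro t
    have h1 : HasDerivAt (fun t : ℝ => (t : ℂ)) 1 t := Complex.ofRealCLM.hasDerivAt
    simpa using (((h1.mul_const u).const_add v).sub_const w).const_mul e
  have hne : ∀ t : ℝ, p ≤ t → t ≤ q → v + t * u - w ≠ 0 := fun t h1 h2 h0 => by
    simpa [h0] using h t h1 h2
  rw [intervalIntegral.integral_eq_sub_of_hasDerivAt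
    (f := fun t : ℝ => log (e * (v + t * u - w)))]
  · intro t ht
    rw [uIcc_of_le hpq] at ht
    have h3 := (hd t).clog_real (h t ht.1 ht.2)
    rwa [mul_div_mul_left _ _ he, div_eq_mul_inv] at h3
  · apply ContinuousOn.intervalIntegrable
    rw [uIcc_of_le hpq]
    refine continuousOn_const.mul (ContinuousOn.inv₀ (by fun_prop) fun t ht => hne t ht.1 ht.2)

theorem log_neg_of_im_pos {z : ℂ} (hz : 0 < z.im) : log (-z) = log z - Real.pi * I := by
  simp [log, arg_neg_eq_arg_sub_pi_of_im_pos hz]; ring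

theorem log_neg_of_im_neg {z : ℂ} (hz : z.im < 0) : log (-z) = log z + Real.pi * I := by
  simp [log, arg_neg_eq_arg_add_pi_of_im_neg hz]; ring

/-- The winding number of a rectangle about an inner point is one. -/
theorem rectIntegral_inv_sub {a b T : ℝ} {w : ℂ} (ha : a < w.re) (hb : w.re < b)
    (hT : |w.im| < T) : rectIntegral (fun s => (s - w)⁻¹) a b T = 2 * Real.pi * I := by
  obtain ⟨hT1, hT2⟩ := abs_lt.1 hT
  have h1 := integral_inv_segment (v := (-T : ℝ) * I) (w := w) (u := 1) (e := 1) one_ne_zero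
    (ha.trans hb).le (fun t _ _ => by
      right; simp; intro h; linarith)
  have h2 := integral_inv_segment (v := T * I) (w := w) (u := 1) (e := 1) one_ne_zero
    (ha.trans hb).le (fun t _ _ => by
      right; simp; intro h; linarith)
  have h3 := integral_inv_segment (v := b) (w := w) (u := I) (e := 1) one_ne_zero
    (p := -T) (q := T) (by linarith) (fun t _ _ => by
      left; simp; linarith)
  have h4 := integral_inv_segment (v := a) (w := w) (u := I) (e := -1) (by norm_num)
    (p := -T) (q := T) (by linarith) (fun t _ _ => by
      left; simp; linarith)
  simp only [one_mul, mul_one, neg_one_mul] at h1 h2 h3 h4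
  -- The principal logarithms at the corners cancel. Changing the branch on the left side costs
  -- `-πi` at the top corner and `+πi` at the bottom one, and this is the whole value `2πi`.
  rw [log_neg_of_im_pos (by simp; linarith), log_neg_of_im_neg (by simp; linarith)] at h4
  have e1 : ∀ x : ℝ, (x : ℂ) + (-T : ℝ) * I = (-T : ℝ) * I + x := fun x => add_comm _ _
  have e2 : ∀ x : ℝ, (x : ℂ) + T * I = T * I + x := fun x => add_comm _ _
  simp only [rectIntegral, e1, e2, h1, h2, h3, h4]
  ring

/-- The boundary of the rectangle `[a, b] × [-T, T]`. -/
def rectBoundary (a b T : ℝ) : Set ℂ :=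
  {z | (z.re ∈ Icc a b ∧ |z.im| = T) ∨ ((z.re = a ∨ z.re = b) ∧ |z.im| ≤ T)}

section rectBoundary

variable {a b T : ℝ}

theorem bottom_mem_rectBoundary (hT : 0 ≤ T) {x : ℝ} (hx : x ∈ Icc a b) :
    (x : ℂ) + (-T : ℝ) * I ∈ rectBoundary a b T := by
  left; simpa [abs_of_nonneg hT] using hx

theorem top_mem_rectBoundary (hT : 0 ≤ T) {x : ℝ} (hx : x ∈ Icc a b) :
    (x : ℂ) + T * I ∈ rectBoundary a b T := by
  left; simpa [abs_of_nonneg hT] using hx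

theorem left_mem_rectBoundary {y : ℝ} (hy : y ∈ Icc (-T) T) :
    (a : ℂ) + y * I ∈ rectBoundary a b T := by
  right; simpa [abs_le] using hy

theorem right_mem_rectBoundary {y : ℝ} (hy : y ∈ Icc (-T) T) :
    (b : ℂ) + y * I ∈ rectBoundary a b T := by
  right; simpa [abs_le] using hy

theorem rectIntegral_congr {f g : ℂ → ℂ} (hab : a ≤ b) (hT : 0 ≤ T)
    (h : EqOn f g (rectBoundary a b T)) : rectIntegral f a b T = rectIntegral g a b T := by
  have hTT : -T ≤ T := by linarith
  simp only [rectIntegral]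
  congr 1
  · congr 1
    · congr 1 <;> refine intervalIntegral.integral_congr fun x hx => ?_ <;>
        rw [uIcc_of_le hab] at hx
      · exact h (bottom_mem_rectBoundary hT hx)
      · exact h (top_mem_rectBoundary hT hx)
    · congr 1
      refine intervalIntegral.integral_congr fun x hx => ?_
      rw [uIcc_of_le hTT] at hx
      exact h (right_mem_rectBoundary hx)
  · congr 1
    refine intervalIntegral.integral_congr fun x hx => ?_
    rw [uIcc_of_le hTT] at hx
    exact h (left_mem_rectBoundary hx)

theorem rectIntegral_add {f g : ℂ → ℂ} (hab : a ≤ b) (hT : 0 ≤ T)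
    (hf : ContinuousOn f (rectBoundary a b T)) (hg : ContinuousOn g (rectBoundary a b T)) :
    rectIntegral (fun z => f z + g z) a b T = rectIntegral f a b T + rectIntegral g a b T := by
  have hTT : -T ≤ T := by linarith
  have key : ∀ {h : ℂ → ℂ} {p q : ℝ} {γ : ℝ → ℂ}, ContinuousOn h (rectBoundary a b T) → p ≤ q →
      Continuous γ → (∀ t ∈ Icc p q, γ t ∈ rectBoundary a b T) →
      IntervalIntegrable (fun t => h (γ t)) volume p q := by
    intro h p q γ hh hpq hγ hm
    apply ContinuousOn.intervalIntegrable
    rw [uIcc_of_le hpq]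
    exact hh.comp hγ.continuousOn hm
  have c1 : Continuous fun x : ℝ => (x : ℂ) + (-T : ℝ) * I := by fun_prop
  have c2 : Continuous fun x : ℝ => (x : ℂ) + T * I := by fun_prop
  have c3 : Continuous fun y : ℝ => (a : ℂ) + y * I := by fun_prop
  have c4 : Continuous fun y : ℝ => (b : ℂ) + y * I := by fun_prop
  simp only [rectIntegral]
  rw [intervalIntegral.integral_add
      (key hf hab c1 fun _ => bottom_mem_rectBoundary hT)
      (key hg hab c1 fun _ => bottom_mem_rectBoundary hT),
    intervalIntegral.integral_add (key hf hab c2 fun _ => top_mem_rectBoundary hT)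
      (key hg hab c2 fun _ => top_mem_rectBoundary hT),
    intervalIntegral.integral_add (key hf hTT c4 fun _ => right_mem_rectBoundary)
      (key hg hTT c4 fun _ => right_mem_rectBoundary),
    intervalIntegral.integral_add (key hf hTT c3 fun _ => left_mem_rectBoundary)
      (key hg hTT c3 fun _ => left_mem_rectBoundary)]
  ring

end rectBoundary

/-- Fubini for a jointly continuous integrand on a compact product: the path `γ` avoids the circle.
It is applied to each side of a rectangle. -/
theorem integral_circleIntegral_inv_sub_mul_swap {h : ℂ → ℂ} {c : ℂ} {R : ℝ} (hR : 0 < R)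
    (hh : ContinuousOn h (Metric.sphere c R)) {p q : ℝ} (hpq : p ≤ q) {γ : ℝ → ℂ}
    (hγ : Continuous γ) (hne : ∀ t ∈ Icc p q, ∀ w ∈ Metric.sphere c R, γ t - w ≠ 0) :
    (∫ t in p..q, ∮ w in C(c, R), (γ t - w)⁻¹ * h w) =
        (∮ w in C(c, R), (∫ t in p..q, (γ t - w)⁻¹) * h w) ∧
      CircleIntegrable (fun w => (∫ t in p..q, (γ t - w)⁻¹) * h w) c R := by
  have hm : ∀ θ, circleMap c R θ ∈ Metric.sphere c R := circleMap_mem_sphere c hR.le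
  have h2π : (0 : ℝ) ≤ 2 * Real.pi := Real.two_pi_pos.le
  set F : ℝ → ℝ → ℂ := fun t θ => deriv (circleMap c R) θ •
    ((γ t - circleMap c R θ)⁻¹ * h (circleMap c R θ)) with hF
  have hcm : Continuous fun x : ℝ × ℝ => circleMap c R x.2 :=
    (continuous_circleMap c R).comp continuous_snd
  have hc : ContinuousOn F.uncurry (Icc p q ×ˢ Icc 0 (2 * Real.pi)) := by
    simp only [hF, Function.uncurry_def, deriv_circleMap]
    have c1 : Continuous fun x : ℝ × ℝ => circleMap 0 R x.2 * I :=
      ((continuous_circleMap 0 R).comp continuous_snd).mul continuous_const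
    have c2 : Continuous fun x : ℝ × ℝ => γ x.1 - circleMap c R x.2 :=
      (hγ.comp continuous_fst).sub hcm
    exact c1.continuousOn.smul ((c2.continuousOn.inv₀ fun x hx => hne _ hx.1 _ (hm _)).mul
      (hh.comp hcm.continuousOn fun x _ => hm _))
  have hFi : IntegrableOn F.uncurry (uIoc p q ×ˢ uIoc 0 (2 * Real.pi)) := by
    rw [uIoc_of_le hpq, uIoc_of_le h2π]
    exact (hc.integrableOn_compact (isCompact_Icc.prod isCompact_Icc)).mono_set
      (prod_mono Ioc_subset_Icc_self Ioc_subset_Icc_self)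
  have e1 : ∀ θ, (∫ t in p..q, F t θ) = deriv (circleMap c R) θ •
      ((∫ t in p..q, (γ t - circleMap c R θ)⁻¹) * h (circleMap c R θ)) := fun θ => by
    simp only [hF, smul_eq_mul]
    rw [← intervalIntegral.integral_mul_const, ← intervalIntegral.integral_const_mul]
  constructor
  · simp only [circleIntegral]
    rw [intervalIntegral_intervalIntegral_swap hFi]
    exact intervalIntegral.integral_congr fun θ _ => e1 θ
  · rw [circleIntegrable_iff, intervalIntegrable_iff]
    have h1 : Integrable F.uncurry
        ((volume.restrict (uIoc p q)).prod (volume.restrict (uIoc 0 (2 * Real.pi)))) := by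
      rw [Measure.prod_restrict, ← Measure.volume_eq_prod]; exact hFi
    refine h1.integral_prod_right.congr (Eventually.of_forall fun θ => ?_)
    simp only [Function.uncurry_apply_pair]
    rw [← e1 θ, intervalIntegral.integral_of_le hpq, uIoc_of_le hpq]

theorem circleIntegral_four_terms {u v p q : ℂ → ℂ} {c : ℂ} {R : ℝ} (hu : CircleIntegrable u c R)
    (hv : CircleIntegrable v c R) (hp : CircleIntegrable p c R) (hq : CircleIntegrable q c R) :
    (∮ w in C(c, R), (u w - v w + I * p w - I * q w)) =
      (∮ w in C(c, R), u w) - (∮ w in C(c, R), v w) + I * (∮ w in C(c, R), p w) -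
        I * ∮ w in C(c, R), q w := by
  have h1 : CircleIntegrable (fun w => u w - v w) c R := hu.sub hv
  have h2 : CircleIntegrable (fun w => I * p w) c R := hp.const_smul
  have h3 : CircleIntegrable (fun w => I * q w) c R := hq.const_smul
  have h4 : CircleIntegrable (fun w => u w - v w + I * p w) c R := h1.add h2
  rw [circleIntegral.integral_sub h4 h3, circleIntegral.integral_add h1 h2,
    circleIntegral.integral_sub hu hv, circleIntegral.integral_const_mul,
    circleIntegral.integral_const_mul]

/-- The integral over a circle of a function analytic outside of it equals the integral over a
rectangle that encloses the circle. -/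
theorem rectIntegral_eq_circleIntegral {f : ℂ → ℂ} {c : ℂ} {R a b T : ℝ} (hR : 0 < R)
    (hf : ∀ z, R ≤ dist z c → DifferentiableAt ℂ f z)
    (ha : a < c.re - R) (hb : c.re + R < b) (hT : |c.im| + R < T) :
    rectIntegral f a b T = ∮ w in C(c, R), f w := by
  obtain ⟨E, hE, hfE⟩ := exists_entire_add_principalPart hR hf
  have hab : a ≤ b := by linarith
  have hT0 : 0 ≤ T := by linarith [abs_nonneg c.im]
  have hTT : -T ≤ T := by linarith
  have hfc : ContinuousOn f (Metric.sphere c R) := fun z hz =>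
    (hf z (Metric.mem_sphere.1 hz).ge).continuousAt.continuousWithinAt
  have hball : ∀ w ∈ Metric.sphere c R, (a < w.re ∧ w.re < b) ∧ |w.im| < T := by
    intro w hw
    have h1 := abs_re_le_norm (w - c)
    have h2 := abs_im_le_norm (w - c)
    rw [← dist_eq_norm, Metric.mem_sphere.1 hw, sub_re, abs_le] at h1
    rw [← dist_eq_norm, Metric.mem_sphere.1 hw, sub_im] at h2
    have h3 := abs_sub_abs_le_abs_sub w.im c.im
    exact ⟨⟨by linarith [h1.1], by linarith [h1.2]⟩, by linarith⟩
  have hout : ∀ z ∈ rectBoundary a b T, R < dist z c := by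
    intro z hz
    have h1 := abs_re_le_norm (z - c)
    have h2 := abs_im_le_norm (z - c)
    rw [← dist_eq_norm, sub_re] at h1
    rw [← dist_eq_norm, sub_im] at h2
    rcases hz with ⟨-, hz⟩ | ⟨hz | hz, -⟩
    · have h3 := abs_sub_abs_le_abs_sub z.im c.im
      linarith
    · rw [hz] at h1; linarith [neg_abs_le (a - c.re)]
    · rw [hz] at h1; linarith [le_abs_self (b - c.re)]
  have hne : ∀ z ∈ rectBoundary a b T, ∀ w ∈ Metric.sphere c R, z - w ≠ 0 := by
    intro z hz w hw h
    rw [sub_eq_zero] at h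
    subst h
    exact (hout z hz).ne' (Metric.mem_sphere.1 hw)
  have hfB : ContinuousOn f (rectBoundary a b T) := fun z hz =>
    (hf z (hout z hz).le).continuousAt.continuousWithinAt
  have hJ : EqOn (fun z => f z - E z) (principalPart f c R) (rectBoundary a b T) := fun z hz => by
    simp only [hfE z (hout z hz)]; ring
  have hJB : ContinuousOn (principalPart f c R) (rectBoundary a b T) :=
    (hfB.sub hE.continuous.continuousOn).congr fun z hz => (hJ hz).symm
  rw [rectIntegral_congr hab hT0 (fun z hz => hfE z (hout z hz)),
    rectIntegral_add hab hT0 hE.continuous.continuousOn hJB,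
    rectIntegral_eq_zero hab (fun z _ _ => hE z), zero_add]
  have s1 := integral_circleIntegral_inv_sub_mul_swap (γ := fun x : ℝ => (x : ℂ) + (-T : ℝ) * I)
    hR hfc hab (by fun_prop) fun t ht => hne _ (bottom_mem_rectBoundary hT0 ht)
  have s2 := integral_circleIntegral_inv_sub_mul_swap (γ := fun x : ℝ => (x : ℂ) + T * I)
    hR hfc hab (by fun_prop) fun t ht => hne _ (top_mem_rectBoundary hT0 ht)
  have s3 := integral_circleIntegral_inv_sub_mul_swap (γ := fun y : ℝ => (b : ℂ) + y * I)
    hR hfc hTT (by fun_prop) fun t ht => hne _ (right_mem_rectBoundary ht)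
  have s4 := integral_circleIntegral_inv_sub_mul_swap (γ := fun y : ℝ => (a : ℂ) + y * I)
    hR hfc hTT (by fun_prop) fun t ht => hne _ (left_mem_rectBoundary ht)
  -- After the exchange, the inner integrals over the four sides add up to the winding integral
  -- about `w`, which is `2πi` for every `w` on the circle.
  have key : (2 * Real.pi * I : ℂ) * rectIntegral (principalPart f c R) a b T =
      2 * Real.pi * I * ∮ w in C(c, R), f w := by
    simp only [rectIntegral, principalPart, intervalIntegral.integral_const_mul]
    rw [s1.1, s2.1, s3.1, s4.1]
    have e : ∀ w ∈ Metric.sphere c R, 2 * Real.pi * I * f w =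
        ((∫ x : ℝ in a..b, ((x : ℂ) + (-T : ℝ) * I - w)⁻¹) * f w -
          (∫ x : ℝ in a..b, ((x : ℂ) + T * I - w)⁻¹) * f w +
          I * ((∫ y : ℝ in (-T)..T, ((b : ℂ) + y * I - w)⁻¹) * f w)) -
          I * ((∫ y : ℝ in (-T)..T, ((a : ℂ) + y * I - w)⁻¹) * f w) := by
      intro w hw
      obtain ⟨⟨h1, h2⟩, h3⟩ := hball w hw
      rw [← rectIntegral_inv_sub h1 h2 h3, rectIntegral]
      ring
    rw [← circleIntegral.integral_const_mul (2 * Real.pi * I : ℂ),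
      circleIntegral.integral_congr hR.le e,
      circleIntegral_four_terms s1.2 s2.2 s3.2 s4.2]
    set A : ℂ := 2 * Real.pi * I with hA
    have hA0 : A ≠ 0 := two_pi_I_ne_zero
    field_simp
  exact mul_left_cancel₀ two_pi_I_ne_zero key

/-- Let `T → ∞`: each horizontal side is at most `M / T ^ 2 * |b - a|`, and the vertical sides
converge by integrability. -/
theorem integral_vertical_sub_of_rectIntegral_eq {f : ℂ → ℂ} {a b T₀ M : ℝ} {K : ℂ} (hab : a ≤ b)
    (hK : ∀ T, T₀ ≤ T → rectIntegral f a b T = K)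
    (ha : Integrable fun y : ℝ => f (a + y * I)) (hb : Integrable fun y : ℝ => f (b + y * I))
    (hM : ∀ z : ℂ, a ≤ z.re → z.re ≤ b → T₀ ≤ |z.im| → ‖f z‖ ≤ M / z.im ^ 2) :
    I * (∫ y : ℝ, f (b + y * I)) - I * ∫ y : ℝ, f (a + y * I) = K := by
  have hv : ∀ {h : ℝ → ℂ}, Integrable h →
      Tendsto (fun T : ℝ => ∫ y in (-T)..T, h y) atTop (𝓝 (∫ y, h y)) := fun hh =>
    intervalIntegral_tendsto_integral hh tendsto_neg_atTop_atBot tendsto_id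
  have hdecay : Tendsto (fun T : ℝ => M / T ^ 2 * |b - a|) atTop (𝓝 0) := by
    have h1 : Tendsto (fun T : ℝ => M / T ^ 2) atTop (𝓝 0) :=
      tendsto_const_nhds.div_atTop (tendsto_pow_atTop two_ne_zero)
    simpa using h1.mul_const |b - a|
  -- The function `e` is `T ↦ -T` or the identity, covering the bottom and top sides together.
  have hh : ∀ e : ℝ → ℝ, (∀ T, |e T| = |T|) →
      Tendsto (fun T : ℝ => ∫ x : ℝ in a..b, f (x + (e T : ℝ) * I)) atTop (𝓝 0) := by
    intro e he
    refine squeeze_zero_norm' ?_ hdecay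
    filter_upwards [eventually_ge_atTop T₀, eventually_ge_atTop 0] with T hT hT0
    refine intervalIntegral.norm_integral_le_of_norm_le_const fun x hx => ?_
    rw [uIoc_of_le hab] at hx
    have h1 : |e T| = T := by rw [he, abs_of_nonneg hT0]
    have h2 := hM (x + (e T : ℝ) * I) (by simpa using hx.1.le) (by simpa using hx.2)
      (by simpa [h1] using hT)
    have h3 : ((x : ℂ) + (e T : ℝ) * I).im = e T := by simp
    rwa [h3, ← sq_abs, h1] at h2
  have h1 := ((((hh (fun T => -T) abs_neg).sub (hh id fun _ => rfl)).add
    ((hv hb).const_mul I)).sub ((hv ha).const_mul I))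
  have h2 : Tendsto (fun T => rectIntegral f a b T) atTop (𝓝 K) :=
    tendsto_const_nhds.congr' (by
      filter_upwards [eventually_ge_atTop T₀] with T hT using (hK T hT).symm)
  have h3 := tendsto_nhds_unique h1 h2
  simpa using h3

/-! ### Phragmén–Lindelöf and decay in strips. -/

/-- Puts the growth hypothesis in the form Phragmén–Lindelöf needs: in the strip `‖z‖` and `|z.im|`
differ by a bounded amount, which only changes the constant before the inner exponential, and the
factor `(z - c) ^ 2` is absorbed there too. -/
theorem sq_mul_isBigO_exp_exp {g : ℂ → ℂ} {a b θ : ℝ} (c : ℂ) (hab : a < b) (hθ : θ < 1)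
    (hO : g =O[Bornology.cobounded ℂ ⊓ 𝓟 {s : ℂ | a ≤ s.re ∧ s.re ≤ b}]
      fun s => Real.exp (Real.exp (θ * Real.pi * ‖s‖ / (b - a)))) :
    ∃ k < Real.pi / (b - a), ∃ B,
      (fun z => (z - c) ^ 2 * g z) =O[comap (abs ∘ im) atTop ⊓ 𝓟 (re ⁻¹' Ioo a b)]
        fun z => Real.exp (B * Real.exp (k * |z.im|)) := by
  have hba : 0 < b - a := by linarith
  have hpi := Real.pi_pos
  -- The midpoint of `max θ 0` and `1`, times `π / (b - a)`: positive even if `θ ≤ 0`, at least `θπ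
  -- / (b - a)`, and strictly below the critical rate.
  set k : ℝ := (max θ 0 + 1) / 2 * (Real.pi / (b - a)) with hk
  have hm : max θ 0 < 1 := max_lt hθ one_pos
  have hm0 : 0 ≤ max θ 0 := le_max_right _ _
  have hq : 0 < Real.pi / (b - a) := by positivity
  have hk0 : 0 < k := by positivity
  have hk1 : k < Real.pi / (b - a) := by
    rw [hk]; nlinarith
  set K : ℝ := |a| + |b| with hKdef
  set B₀ : ℝ := Real.exp (k * K) with hB₀
  refine ⟨k, hk1, B₀ + 2, ?_⟩
  have hre : ∀ z ∈ re ⁻¹' Ioo a b, ‖z‖ ≤ |z.im| + K := by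
    intro z hz
    have h1 : |z.re| ≤ K := by
      rw [hKdef, abs_le]
      constructor
      · linarith [hz.1, neg_abs_le a, abs_nonneg b]
      · linarith [hz.2, le_abs_self b, abs_nonneg a]
    linarith [norm_le_abs_re_add_abs_im z]
  have hfilter : comap (abs ∘ im) atTop ⊓ 𝓟 (re ⁻¹' Ioo a b) ≤
      Bornology.cobounded ℂ ⊓ 𝓟 {s : ℂ | a ≤ s.re ∧ s.re ≤ b} := by
    refine inf_le_inf ?_ (principal_mono.2 fun z hz => ⟨hz.1.le, hz.2.le⟩)
    rw [← comap_norm_atTop, ← tendsto_iff_comap]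
    exact tendsto_atTop_mono (fun z => abs_im_le_norm z) tendsto_comap
  have hg := hO.mono hfilter
  have hstrip : ∀ᶠ z in comap (abs ∘ im) atTop ⊓ 𝓟 (re ⁻¹' Ioo a b), z ∈ re ⁻¹' Ioo a b :=
    mem_inf_of_right (mem_principal_self _)
  have hg' : g =O[comap (abs ∘ im) atTop ⊓ 𝓟 (re ⁻¹' Ioo a b)]
      fun z => Real.exp (B₀ * Real.exp (k * |z.im|)) := by
    refine hg.trans (IsBigO.of_bound 1 ?_)
    filter_upwards [hstrip] with z hz
    rw [Real.norm_of_nonneg (Real.exp_pos _).le, Real.norm_of_nonneg (Real.exp_pos _).le, one_mul,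
      hB₀, ← Real.exp_add]
    gcongr
    have h1 : θ * Real.pi * ‖z‖ / (b - a) = θ * (Real.pi / (b - a)) * ‖z‖ := by ring
    have h2 : θ * (Real.pi / (b - a)) ≤ k := by
      rw [hk]
      gcongr
      linarith [le_max_left θ 0]
    rw [h1]
    calc θ * (Real.pi / (b - a)) * ‖z‖ ≤ k * ‖z‖ := by gcongr
      _ ≤ k * (|z.im| + K) := by gcongr; exact hre z hz
      _ = k * K + k * |z.im| := by ring
  have hp : (fun z : ℂ => (z - c) ^ 2) =O[comap (abs ∘ im) atTop ⊓ 𝓟 (re ⁻¹' Ioo a b)]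
      fun z => Real.exp (2 * Real.exp (k * |z.im|)) := by
    refine IsBigO.of_bound ((K + ‖c‖ + 1 / k) ^ 2) ?_
    filter_upwards [hstrip] with z hz
    rw [Real.norm_of_nonneg (Real.exp_pos _).le, norm_pow, two_mul (Real.exp _), Real.exp_add,
      ← sq, ← mul_pow]
    gcongr
    set u := Real.exp (k * |z.im|) with hu
    have hu1 : 1 ≤ u := Real.one_le_exp (by positivity)
    have hu2 : |z.im| ≤ 1 / k * u := by
      have := Real.add_one_le_exp (k * |z.im|)
      rw [one_div, ← div_eq_inv_mul, le_div_iff₀ hk0]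
      linarith
    have hu3 : u ≤ Real.exp u := by linarith [Real.add_one_le_exp u]
    have hK0 : 0 ≤ K := by positivity
    calc ‖z - c‖ ≤ ‖z‖ + ‖c‖ := norm_sub_le _ _
      _ ≤ |z.im| + K + ‖c‖ := by linarith [hre z hz]
      _ ≤ 1 / k * u + (K + ‖c‖) * u := by
        have : K + ‖c‖ ≤ (K + ‖c‖) * u := le_mul_of_one_le_right (by positivity) hu1
        linarith
      _ = (K + ‖c‖ + 1 / k) * u := by ring
      _ ≤ (K + ‖c‖ + 1 / k) * Real.exp u := by gcongr
  refine (hp.mul hg').congr_right fun z => ?_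
  rw [← Real.exp_add]; congr 1; ring

/-- Phragmén–Lindelöf in a vertical strip for a function with singularities in a disc, in the form
of decay of order two. -/
theorem sq_mul_norm_bounded_of_isBigO {g : ℂ → ℂ} {c : ℂ} {R a b θ M : ℝ} (hR : 0 < R)
    (hg : ∀ z, R ≤ dist z c → DifferentiableAt ℂ g z)
    (ha : a ≤ c.re - R - 1) (hb : c.re + R + 1 ≤ b) (hθ : θ < 1)
    (hO : g =O[Bornology.cobounded ℂ ⊓ 𝓟 {s : ℂ | a ≤ s.re ∧ s.re ≤ b}]
      fun s => Real.exp (Real.exp (θ * Real.pi * ‖s‖ / (b - a))))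
    (hla : ∀ z : ℂ, z.re = a → ‖(z - c) ^ 2 * g z‖ ≤ M)
    (hlb : ∀ z : ℂ, z.re = b → ‖(z - c) ^ 2 * g z‖ ≤ M) :
    ∃ M', ∀ z : ℂ, a ≤ z.re → z.re ≤ b → R + 1 ≤ dist z c → ‖(z - c) ^ 2 * g z‖ ≤ M' := by
  set h : ℂ → ℂ := fun z => (z - c) ^ 2 * g z with hh
  have hd : ∀ z, R ≤ dist z c → DifferentiableAt ℂ h z := fun z hz =>
    ((differentiableAt_id.sub_const c).pow 2).mul (hg z hz)
  obtain ⟨E, hE, hhE⟩ := exists_entire_add_principalPart hR hd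
  obtain ⟨N, hN0, hN⟩ := norm_principalPart_le (g := h) (c := c) hR fun z hz =>
    (hd z (Metric.mem_sphere.1 hz).ge).continuousAt.continuousWithinAt
  -- Keeping distance one from the disc makes the decaying bound `N / (dist z c - R)` at most `N`.
  -- Both edges of the strip satisfy this.
  have hN' : ∀ z, R + 1 ≤ dist z c → ‖principalPart h c R z‖ ≤ N := fun z hz =>
    (hN z (by linarith)).trans (div_le_self hN0 (by linarith))
  have hdist : ∀ z : ℂ, z.re = a ∨ z.re = b → R + 1 ≤ dist z c := by
    intro z hz
    have h1 := abs_re_le_norm (z - c)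
    rw [← dist_eq_norm, sub_re] at h1
    rcases hz with hz | hz <;> rw [hz] at h1
    · linarith [neg_abs_le (a - c.re)]
    · linarith [le_abs_self (b - c.re)]
  have hEeq : ∀ z, R + 1 ≤ dist z c → E z = h z - principalPart h c R z := fun z hz => by
    rw [hhE z (by linarith)]; ring
  have hEb : ∀ z : ℂ, R + 1 ≤ dist z c → ‖h z‖ ≤ M → ‖E z‖ ≤ M + N := fun z hz hM => by
    rw [hEeq z hz]
    exact (norm_sub_le _ _).trans (add_le_add hM (hN' z hz))
  obtain ⟨k, hk, B, hB⟩ := sq_mul_isBigO_exp_exp c (by linarith) hθ hO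
  have hfar : ∀ᶠ z in comap (abs ∘ im) atTop ⊓ 𝓟 (re ⁻¹' Ioo a b), R + 1 ≤ dist z c := by
    have : ∀ᶠ z in comap (abs ∘ im) atTop, R + 1 + |c.im| ≤ |z.im| :=
      (tendsto_comap (f := abs ∘ im) (x := atTop)).eventually (eventually_ge_atTop _)
    filter_upwards [this.filter_mono inf_le_left] with z hz
    have h2 := abs_im_le_norm (z - c)
    rw [← dist_eq_norm, sub_im] at h2
    linarith [abs_sub_abs_le_abs_sub z.im c.im]
  have hEO : E =O[comap (abs ∘ im) atTop ⊓ 𝓟 (re ⁻¹' Ioo a b)]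
      fun z => Real.exp (max B 0 * Real.exp (k * |z.im|)) := by
    have h1 : h =O[comap (abs ∘ im) atTop ⊓ 𝓟 (re ⁻¹' Ioo a b)]
        fun z => Real.exp (max B 0 * Real.exp (k * |z.im|)) := by
      refine hB.trans (IsBigO.of_bound 1 (Eventually.of_forall fun z => ?_))
      rw [Real.norm_of_nonneg (Real.exp_pos _).le, Real.norm_of_nonneg (Real.exp_pos _).le, one_mul]
      gcongr
      exact le_max_left _ _
    have h2 : principalPart h c R =O[comap (abs ∘ im) atTop ⊓ 𝓟 (re ⁻¹' Ioo a b)]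
        fun z => Real.exp (max B 0 * Real.exp (k * |z.im|)) := by
      refine IsBigO.of_bound N ?_
      filter_upwards [hfar] with z hz
      refine (hN' z hz).trans (le_mul_of_one_le_right hN0 ?_)
      rw [Real.norm_of_nonneg (Real.exp_pos _).le]
      exact Real.one_le_exp (by positivity)
    exact (h1.sub h2).congr' (hfar.mono fun z hz => (hEeq z hz).symm) EventuallyEq.rfl
  refine ⟨M + N + N, fun z hza hzb hz => ?_⟩
  have h1 : ‖E z‖ ≤ M + N := PhragmenLindelof.vertical_strip hE.diffContOnCl ⟨k, hk, _, hEO⟩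
    (fun z hz => hEb z (hdist z (.inl hz)) (hla z hz))
    (fun z hz => hEb z (hdist z (.inr hz)) (hlb z hz)) hza hzb
  rw [show (z - c) ^ 2 * g z = E z + principalPart h c R z from hhE z (by linarith)]
  exact (norm_add_le _ _).trans (add_le_add h1 (hN' z hz))

/-! ### Decay of the Gamma factors and the functions `Z`. -/

theorem norm_Gamma_le_Gamma_re {z : ℂ} (hz : 0 < z.re) : ‖Complex.Gamma z‖ ≤ Real.Gamma z.re := by
  rw [Complex.Gamma_eq_integral hz, Real.Gamma_eq_integral hz, GammaIntegral]
  refine (norm_integral_le_integral_norm _).trans_eq ?_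
  refine setIntegral_congr_fun measurableSet_Ioi fun x hx => ?_
  simp only [norm_mul, norm_cpow_eq_rpow_re_of_pos hx, sub_re, one_re]
  rw [Complex.norm_real, Real.norm_of_nonneg (Real.exp_pos _).le]

/-- Iterating `Γ(z + 1) = z Γ(z)` trades each power of `‖z‖` for a unit shift, as `‖z‖ ≤ ‖z + 1‖` in
the right half-plane. This gives decay of any polynomial order on vertical lines. -/
theorem norm_pow_mul_norm_Gamma_le (N : ℕ) : ∀ {z : ℂ}, 0 < z.re →
    ‖z‖ ^ N * ‖Complex.Gamma z‖ ≤ Real.Gamma (z.re + N) := by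
  induction N with
  | zero => intro z hz; simpa using norm_Gamma_le_Gamma_re hz
  | succ N ih =>
    intro z hz
    have h0 : z ≠ 0 := by rintro rfl; simp at hz
    have h1 := ih (z := z + 1) (by simp; linarith)
    rw [Complex.Gamma_add_one z h0, norm_mul] at h1
    have h2 : ‖z‖ ≤ ‖z + 1‖ := by
      rw [Complex.norm_def, Complex.norm_def]
      apply Real.sqrt_le_sqrt
      simp only [normSq_apply, add_re, one_re, add_im, one_im, add_zero]
      nlinarith
    calc ‖z‖ ^ (N + 1) * ‖Complex.Gamma z‖ = ‖z‖ ^ N * (‖z‖ * ‖Complex.Gamma z‖) := by ring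
      _ ≤ ‖z + 1‖ ^ N * (‖z‖ * ‖Complex.Gamma z‖) := by gcongr
      _ ≤ _ := h1
      _ = _ := by rw [add_re, one_re]; push_cast; ring_nf

theorem exists_Gamma_affine_bound {α : ℝ} (hα : 0 < α) {β : ℂ} (hβ : 0 ≤ β.re) {p q : ℝ}
    (hp : 0 < p) (N : ℕ) : ∃ M, 0 ≤ M ∧ ∀ s : ℂ, p ≤ s.re → s.re ≤ q →
      (1 + |s.im|) ^ N * ‖Complex.Gamma (α * s + β)‖ ≤ M := by
  have hαp : 0 < α * p := mul_pos hα hp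
  have hc : ContinuousOn (fun x : ℝ => Real.Gamma (x + N)) (Icc (α * p) (α * q + β.re)) := by
    intro x hx
    have hx0 : 0 < x + N := by linarith [hx.1, N.cast_nonneg (α := ℝ)]
    have h1 : ContinuousAt Real.Gamma (x + N) :=
      (Real.differentiableAt_Gamma fun m => by
        have : (0 : ℝ) ≤ m := m.cast_nonneg
        linarith).continuousAt
    exact (ContinuousAt.comp (f := fun x : ℝ => x + N) h1 (by fun_prop)).continuousWithinAt
  obtain ⟨G, hG⟩ := isCompact_Icc.exists_bound_of_continuousOn hc
  -- Chosen so that `1 + |s.im| ≤ C * ‖α s + β‖`: the first term controls `|s.im|`, and the second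
  -- turns the constant `1 + |β.im| / α` into a multiple of the norm, which is at least `α * p`.
  set C : ℝ := 1 / α + (1 + |β.im| / α) / (α * p) with hC
  have hC0 : 0 ≤ C := by positivity
  refine ⟨C ^ N * |G|, by positivity, fun s h1 h2 => ?_⟩
  set z : ℂ := α * s + β with hz
  have hre : z.re = α * s.re + β.re := by simp [hz]
  have him : z.im = α * s.im + β.im := by simp [hz]
  have hzp : α * p ≤ z.re := by rw [hre]; nlinarith
  have hzq : z.re ≤ α * q + β.re := by rw [hre]; nlinarith
  have hzn : α * p ≤ ‖z‖ := hzp.trans (re_le_norm z)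
  have h3 : 1 + |s.im| ≤ C * ‖z‖ := by
    have h4 : α * |s.im| ≤ ‖z‖ + |β.im| := by
      have h5 : α * |s.im| = |z.im - β.im| := by
        rw [him, add_sub_cancel_right, abs_mul, abs_of_pos hα]
      rw [h5]
      exact (abs_sub _ _).trans (by linarith [abs_im_le_norm z])
    have h6 : |s.im| ≤ (‖z‖ + |β.im|) / α := by rw [le_div_iff₀ hα]; linarith
    have h7 : (1 + |β.im| / α) ≤ (1 + |β.im| / α) / (α * p) * ‖z‖ := by
      rw [div_mul_eq_mul_div, le_div_iff₀ hαp]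
      gcongr
    have h8 : C * ‖z‖ = ‖z‖ / α + (1 + |β.im| / α) / (α * p) * ‖z‖ := by rw [hC]; ring
    rw [h8]
    rw [add_div] at h6
    linarith
  calc (1 + |s.im|) ^ N * ‖Complex.Gamma z‖ ≤ (C * ‖z‖) ^ N * ‖Complex.Gamma z‖ := by gcongr
    _ = C ^ N * (‖z‖ ^ N * ‖Complex.Gamma z‖) := by rw [mul_pow, mul_assoc]
    _ ≤ C ^ N * Real.Gamma (z.re + N) := by
      gcongr; exact norm_pow_mul_norm_Gamma_le N (hαp.trans_le hzp)
    _ ≤ C ^ N * |G| := by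
      gcongr
      exact (le_abs_self _).trans ((hG z.re ⟨hzp, hzq⟩).trans (le_abs_self G))

section gammaFactor

variable {r : ℕ} {α : Fin r → ℝ} {β : Fin r → ℂ}

/-- Every factor absorbs a square of `1 + |s.im|`, and `r ≥ 1` guarantees at least one such square.
-/
theorem exists_gammaFactor_bound (hr : 0 < r) (hα : ∀ i, 0 < α i) (hβ : ∀ i, 0 ≤ (β i).re)
    {p q : ℝ} (hp : 0 < p) : ∃ M, 0 ≤ M ∧ ∀ s : ℂ, p ≤ s.re → s.re ≤ q →
      (1 + |s.im|) ^ 2 * ‖gammaFactor α β s‖ ≤ M := by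
  choose M hM0 hM using fun i => exists_Gamma_affine_bound (hα i) (hβ i) (q := q) hp 2
  refine ⟨∏ i, M i, Finset.prod_nonneg fun i _ => hM0 i, fun s h1 h2 => ?_⟩
  have h3 : (1 : ℝ) ≤ (1 + |s.im|) ^ 2 := one_le_pow₀ (by linarith [abs_nonneg s.im])
  calc (1 + |s.im|) ^ 2 * ‖gammaFactor α β s‖
      ≤ ((1 + |s.im|) ^ 2) ^ r * ‖gammaFactor α β s‖ := by
        gcongr; exact le_self_pow₀ h3 hr.ne'
    _ = ∏ i, (1 + |s.im|) ^ 2 * ‖Complex.Gamma (α i * s + β i)‖ := by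
        rw [gammaFactor, norm_prod, Finset.prod_mul_distrib]; simp
    _ ≤ ∏ i, M i := Finset.prod_le_prod (fun i _ => by positivity) fun i _ => hM i s h1 h2

theorem affine_re_pos (hα : ∀ i, 0 < α i) (hβ : ∀ i, 0 ≤ (β i).re) {s : ℂ} (hs : 0 < s.re)
    (i : Fin r) : 0 < ((α i : ℂ) * s + β i).re := by
  have := mul_pos (hα i) hs
  have := hβ i
  simp; linarith

theorem not_isGammaPole (hα : ∀ i, 0 < α i) (hβ : ∀ i, 0 ≤ (β i).re) {s : ℂ} (hs : 0 < s.re) :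
    ¬ IsGammaPole α β s := by
  rintro ⟨i, m, h⟩
  have h1 := affine_re_pos hα hβ hs i
  rw [h] at h1
  simp at h1
  linarith [m.cast_nonneg (α := ℝ)]

theorem differentiableAt_gammaFactor (hα : ∀ i, 0 < α i) (hβ : ∀ i, 0 ≤ (β i).re) {s : ℂ}
    (hs : 0 < s.re) : DifferentiableAt ℂ (gammaFactor α β) s := by
  unfold gammaFactor
  refine DifferentiableAt.fun_finsetProd fun i _ => ?_
  refine DifferentiableAt.comp s (differentiableAt_Gamma _ fun m h => ?_) (by fun_prop)
  exact not_isGammaPole hα hβ hs ⟨i, m, h⟩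

theorem integrable_of_sq_mul_le {f : ℝ → ℂ} (hf : Continuous f) {M : ℝ}
    (hM : ∀ y, (1 + |y|) ^ 2 * ‖f y‖ ≤ M) : Integrable f := by
  refine (integrable_inv_one_add_sq.const_mul M).mono' hf.aestronglyMeasurable
    (Eventually.of_forall fun y => ?_)
  rw [← div_eq_mul_inv, le_div_iff₀ (by positivity), mul_comm]
  refine le_trans ?_ (hM y)
  gcongr
  nlinarith [sq_abs y, abs_nonneg y]

theorem norm_ofReal_cpow_neg {x : ℝ} (hx : 0 < x) (s : ℂ) :
    ‖(x : ℂ) ^ (-s)‖ = x ^ (-s.re) := by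
  rw [norm_cpow_eq_rpow_re_of_pos hx, neg_re]

theorem differentiable_ofReal_cpow_neg {x : ℝ} (hx : 0 < x) :
    Differentiable ℂ fun s : ℂ => (x : ℂ) ^ (-s) := fun s =>
  (differentiableAt_id.neg).const_cpow (.inl (by exact_mod_cast hx.ne'))

theorem continuous_vertical_gammaFactor (hα : ∀ i, 0 < α i) (hβ : ∀ i, 0 ≤ (β i).re) {κ : ℝ}
    (hκ : 0 < κ) : Continuous fun y : ℝ => gammaFactor α β (κ + y * I) := by
  rw [continuous_iff_continuousAt]
  intro y
  exact ContinuousAt.comp (f := fun y : ℝ => (κ : ℂ) + y * I)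
    (differentiableAt_gammaFactor hα hβ (by simpa using hκ)).continuousAt (by fun_prop)

theorem integrable_vertical_gammaFactor (hr : 0 < r) (hα : ∀ i, 0 < α i)
    (hβ : ∀ i, 0 ≤ (β i).re) {κ : ℝ} (hκ : 0 < κ) :
    Integrable fun y : ℝ => gammaFactor α β (κ + y * I) := by
  obtain ⟨M, -, hM⟩ := exists_gammaFactor_bound hr hα hβ (q := κ) hκ
  exact integrable_of_sq_mul_le (continuous_vertical_gammaFactor hα hβ hκ) fun y => by
    simpa using hM (κ + y * I) (by simp) (by simp)

theorem verticalIntegrable_cpow_mul_gammaFactor (hr : 0 < r) (hα : ∀ i, 0 < α i)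
    (hβ : ∀ i, 0 ≤ (β i).re) {κ : ℝ} (hκ : 0 < κ) {x : ℝ} (hx : 0 < x) :
    VerticalIntegrable (fun s => (x : ℂ) ^ (-s) * gammaFactor α β s) κ := by
  refine (integrable_vertical_gammaFactor hr hα hβ hκ).bdd_mul (c := x ^ (-κ))
    (Continuous.aestronglyMeasurable ?_) (Eventually.of_forall fun y => ?_)
  · exact (differentiable_ofReal_cpow_neg hx).continuous.comp (by fun_prop)
  · rw [norm_ofReal_cpow_neg hx]; simp

/-- The integral defining `zFun` does not depend on the line of integration. -/
theorem zFun_congr_line (hr : 0 < r) (hα : ∀ i, 0 < α i) (hβ : ∀ i, 0 ≤ (β i).re) {κ κ' : ℝ}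
    (hκ : 0 < κ) (hκ' : 0 < κ') {x : ℝ} (hx : 0 < x) : zFun α β κ x = zFun α β κ' x := by
  wlog h : κ ≤ κ' generalizing κ κ'
  · exact (this hκ' hκ (not_le.1 h).le).symm
  obtain ⟨M, hM0, hM⟩ := exists_gammaFactor_bound hr hα hβ (q := κ') hκ
  have hX : ContinuousOn (fun y : ℝ => x ^ (-y)) (Icc κ κ') :=
    ((Real.continuous_const_rpow hx.ne').comp continuous_neg).continuousOn
  obtain ⟨X, hX⟩ := isCompact_Icc.exists_bound_of_continuousOn hX
  have key := integral_vertical_sub_of_rectIntegral_eq (K := 0) (T₀ := 1) (M := |X| * M)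
    (f := fun s => (x : ℂ) ^ (-s) * gammaFactor α β s) h (fun T hT => ?_)
    (verticalIntegrable_cpow_mul_gammaFactor hr hα hβ hκ hx)
    (verticalIntegrable_cpow_mul_gammaFactor hr hα hβ hκ' hx) (fun z hz1 hz2 hz3 => ?_)
  · simp only [zFun, mellinInv, smul_eq_mul]
    congr 1
    rw [← mul_sub, mul_eq_zero, or_iff_right I_ne_zero, sub_eq_zero] at key
    exact key.symm
  · exact rectIntegral_eq_zero h fun z hz _ =>
      (differentiable_ofReal_cpow_neg hx z).mul
        (differentiableAt_gammaFactor hα hβ (hκ.trans_le hz))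
  · have h1 : 0 < |z.im| := by linarith
    rw [norm_mul, norm_ofReal_cpow_neg hx, mul_div_assoc]
    refine mul_le_mul ((le_abs_self _).trans ((hX _ ⟨hz1, hz2⟩).trans (le_abs_self X))) ?_
      (norm_nonneg _) (abs_nonneg X)
    rw [← sq_abs, le_div_iff₀ (by positivity), mul_comm]
    refine le_trans ?_ (hM z hz1 hz2)
    gcongr
    linarith

end gammaFactor

/-! ### Dirichlet series and their inverse Mellin transforms. -/

section dirichletSeries

variable {c : ℕ → ℂ} {ν : ℕ → ℝ} {σ : ℝ}

theorem IsDirichletSeries.summable_norm (h : IsDirichletSeries c ν σ) {σ' : ℝ} (hσ : σ < σ') :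
    Summable fun n => ‖c n‖ / ν n ^ σ' := by
  have h1 : abscissaAbs c ν < (σ' : EReal) := by rw [h.abscissa]; exact_mod_cast hσ
  obtain ⟨_, ⟨y, hy, rfl⟩, hlt⟩ := sInf_lt_iff.1 h1
  have hlt : y < σ' := EReal.coe_lt_coe_iff.1 hlt
  refine Summable.of_norm_bounded_eventually_nat (g := fun n => ‖c n‖ / ν n ^ y) hy ?_
  filter_upwards [h.tendsto.eventually_ge_atTop 1] with n hn
  have h0 := h.pos n
  rw [Real.norm_of_nonneg (by positivity)]
  gcongr

theorem IsDirichletSeries.star (h : IsDirichletSeries c ν σ) :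
    IsDirichletSeries (fun n => (starRingEnd ℂ) (c n)) ν σ :=
  ⟨h.pos, h.strictMono, h.tendsto, by rw [← h.abscissa]; simp [abscissaAbs]⟩

theorem norm_dirichletSeries_term (hν : ∀ n, 0 < ν n) (s : ℂ) (n : ℕ) :
    ‖c n / (ν n : ℂ) ^ s‖ = ‖c n‖ / ν n ^ s.re := by
  rw [norm_div, norm_cpow_eq_rpow_re_of_pos (hν n)]

theorem IsDirichletSeries.norm_le (h : IsDirichletSeries c ν σ) {s : ℂ} (hs : σ < s.re) :
    ‖dirichletSeries c ν s‖ ≤ ∑' n, ‖c n‖ / ν n ^ s.re := by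
  simp only [← norm_dirichletSeries_term h.pos s]
  refine norm_tsum_le_tsum_norm ?_
  simpa only [norm_dirichletSeries_term h.pos s] using h.summable_norm hs

theorem conj_ofReal_cpow {x : ℝ} (hx : 0 < x) (s : ℂ) :
    (starRingEnd ℂ) ((x : ℂ) ^ s) = (x : ℂ) ^ (starRingEnd ℂ) s := by
  rw [cpow_conj _ _ (by rw [arg_ofReal_of_nonneg hx.le]; exact Real.pi_pos.ne), conj_ofReal]

theorem conj_dirichletSeries (hν : ∀ n, 0 < ν n) (s : ℂ) :
    (starRingEnd ℂ) (dirichletSeries c ν s) =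
      dirichletSeries (fun n => (starRingEnd ℂ) (c n)) ν ((starRingEnd ℂ) s) := by
  simp only [dirichletSeries, conj_tsum, map_div₀, conj_ofReal_cpow (hν _)]

theorem conj_gammaFactor {r : ℕ} (α : Fin r → ℝ) (β : Fin r → ℂ) (s : ℂ) :
    (starRingEnd ℂ) (gammaFactor α β s) =
      gammaFactor α (fun i => (starRingEnd ℂ) (β i)) ((starRingEnd ℂ) s) := by
  simp [gammaFactor, map_prod, ← Complex.Gamma_conj]

theorem conj_completedSeries {r : ℕ} (hν : ∀ n, 0 < ν n) (α : Fin r → ℝ) (β : Fin r → ℂ) (s : ℂ) :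
    (starRingEnd ℂ) (completedSeries c ν α β s) =
      completedSeries (fun n => (starRingEnd ℂ) (c n)) ν α (fun i => (starRingEnd ℂ) (β i))
        ((starRingEnd ℂ) s) := by
  simp only [completedSeries, map_mul, conj_dirichletSeries hν, conj_gammaFactor]

variable {r : ℕ} {α : Fin r → ℝ} {β : Fin r → ℂ}

theorem IsDirichletSeries.exists_completedSeries_bound (h : IsDirichletSeries c ν σ) (hr : 0 < r)
    (hα : ∀ i, 0 < α i) (hβ : ∀ i, 0 ≤ (β i).re) {κ : ℝ} (hσ : σ < κ) (hκ : 0 < κ) :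
    ∃ M, 0 ≤ M ∧ ∀ s : ℂ, s.re = κ → (1 + |s.im|) ^ 2 * ‖completedSeries c ν α β s‖ ≤ M := by
  obtain ⟨M, hM0, hM⟩ := exists_gammaFactor_bound hr hα hβ (q := κ) hκ
  have h0 : 0 ≤ ∑' n, ‖c n‖ / ν n ^ κ := tsum_nonneg fun n => by have := h.pos n; positivity
  refine ⟨(∑' n, ‖c n‖ / ν n ^ κ) * M, by positivity, fun s hs => ?_⟩
  rw [completedSeries, norm_mul, mul_left_comm]
  gcongr
  · have h1 := h.norm_le (s := s) (hs ▸ hσ)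
    rwa [hs] at h1
  · exact hM s hs.ge hs.le

/-- The series `∑ c n * Z(ν n * x)` is the inverse Mellin transform of the completed series. -/
theorem IsDirichletSeries.hasSum_mul_zFun (h : IsDirichletSeries c ν σ) (hr : 0 < r)
    (hα : ∀ i, 0 < α i) (hβ : ∀ i, 0 ≤ (β i).re) {κ κ' : ℝ} (hκ : 0 < κ) (hκ' : 0 < κ')
    (hσ : σ < κ') {x : ℝ} (hx : 0 < x) :
    HasSum (fun n => c n * zFun α β κ (ν n * x))
      (mellinInv κ' (completedSeries c ν α β) x) := by
  have hi := integrable_vertical_gammaFactor hr hα hβ hκ'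
  set F : ℕ → ℝ → ℂ := fun n y => c n * (((ν n * x : ℝ) : ℂ) ^ (-((κ' : ℂ) + y * I)) *
    gammaFactor α β (κ' + y * I)) with hF
  have hFi : ∀ n, Integrable (F n) := fun n =>
    (verticalIntegrable_cpow_mul_gammaFactor hr hα hβ hκ' (mul_pos (h.pos n) hx)).const_mul (c n)
  have hFn : ∀ n y, ‖F n y‖ =
      ‖c n‖ / ν n ^ κ' * x ^ (-κ') * ‖gammaFactor α β (κ' + y * I)‖ := fun n y => by
    have h0 := h.pos n
    simp only [hF, norm_mul]
    rw [norm_ofReal_cpow_neg (mul_pos h0 hx), Real.mul_rpow h0.le hx.le]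
    simp [Real.rpow_neg h0.le, div_eq_mul_inv]
    ring
  have hFs : Summable fun n => ∫ y, ‖F n y‖ := by
    simp only [hFn, integral_const_mul]
    exact ((h.summable_norm hσ).mul_right _).mul_right _
  have h1 := (hasSum_integral_of_summable_integral_norm hFi hFs).const_smul (1 / (2 * Real.pi))
  have e1 : ∀ y : ℝ, ∑' n, F n y =
      (x : ℂ) ^ (-((κ' : ℂ) + y * I)) • completedSeries c ν α β (κ' + y * I) := fun y => by
    simp only [completedSeries, dirichletSeries, smul_eq_mul]
    rw [← tsum_mul_right, ← tsum_mul_left]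
    refine tsum_congr fun n => ?_
    simp only [hF]
    rw [ofReal_mul, mul_cpow_ofReal_nonneg (h.pos n).le hx.le, cpow_neg (ν n : ℂ)]
    ring
  simp only [e1] at h1
  have e2 : (fun n => c n * zFun α β κ (ν n * x)) =
      fun n => (1 / (2 * Real.pi)) • ∫ y, F n y := funext fun n => by
    -- The line `κ` is any positive one, whereas the exchange of sum and integral needs `σ < κ'`;
    -- independence of the line reconciles them.
    rw [zFun_congr_line hr hα hβ hκ hκ' (mul_pos (h.pos n) hx)]
    simp only [zFun, mellinInv, hF, integral_const_mul, smul_eq_mul, real_smul]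
    ring
  rw [e2]
  exact h1

end dirichletSeries

/-! ### The circle integral `P` as a residual function. -/

/-- In the variable `u = log x` the kernel `x ^ (-s)` becomes `exp (-s * u)`, and differentiation
under the integral is dominated on the unit ball about `u`. -/
theorem differentiableAt_circleIntegral_mul_exp {F : ℂ → ℂ} {c : ℂ} {R : ℝ} (hR : 0 < R)
    (hF : ContinuousOn F (Metric.sphere c R)) (u : ℝ) :
    DifferentiableAt ℝ (fun u : ℝ => ∮ s in C(c, R), F s * exp (-s * u)) u := by
  have hm : ∀ θ, circleMap c R θ ∈ Metric.sphere c R := circleMap_mem_sphere c hR.le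
  have hFc : Continuous fun θ => F (circleMap c R θ) :=
    hF.comp_continuous (continuous_circleMap c R) hm
  have hd : Continuous fun θ => deriv (circleMap c R) θ := by
    simp only [deriv_circleMap]
    exact (continuous_circleMap 0 R).mul continuous_const
  have hc := continuous_circleMap c R
  obtain ⟨B, hB⟩ := (isCompact_sphere c R).exists_bound_of_continuousOn
    (f := fun s => F s * s) (hF.mul continuousOn_id)
  have hk : ∀ w ∈ Metric.sphere c R, ‖w‖ ≤ ‖c‖ + R := fun w hw => by
    have := norm_sub_norm_le w c
    rw [← dist_eq_norm, Metric.mem_sphere.1 hw] at this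
    linarith
  have key := intervalIntegral.hasDerivAt_integral_of_dominated_loc_of_deriv_le (𝕜 := ℝ)
    (μ := volume) (a := 0) (b := 2 * Real.pi)
    (F := fun u θ => deriv (circleMap c R) θ • (F (circleMap c R θ) *
      exp (-circleMap c R θ * (u : ℝ))))
    (F' := fun u θ => deriv (circleMap c R) θ • (F (circleMap c R θ) *
      (exp (-circleMap c R θ * (u : ℝ)) * (-circleMap c R θ))))
    (x₀ := u) (s := Metric.ball u 1) (bound := fun _ => R * (|B| * Real.exp ((‖c‖ + R) * (|u| + 1))))
    (Metric.ball_mem_nhds u one_pos) (Eventually.of_forall fun v => ?_) ?_ ?_ ?_ ?_ ?_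
  · simp only [circleIntegral]
    exact key.2.differentiableAt
  · exact (hd.smul (hFc.mul (by fun_prop))).aestronglyMeasurable
  · exact (hd.smul (hFc.mul (by fun_prop))).intervalIntegrable _ _
  · exact (hd.smul (hFc.mul (by fun_prop))).aestronglyMeasurable
  · refine Eventually.of_forall fun θ _ v hv => ?_
    have h1 : ‖exp (-circleMap c R θ * (v : ℝ))‖ ≤ Real.exp ((‖c‖ + R) * (|u| + 1)) := by
      rw [norm_exp]
      apply Real.exp_le_exp.2
      refine (re_le_norm _).trans ?_
      rw [norm_mul, norm_neg, norm_real, Real.norm_eq_abs]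
      have h2 : |v| ≤ |u| + 1 := by
        have := Metric.mem_ball.1 hv
        rw [Real.dist_eq] at this
        linarith [abs_sub_abs_le_abs_sub v u]
      exact mul_le_mul (hk _ (hm θ)) h2 (abs_nonneg v) (by positivity)
    have h3 : ‖F (circleMap c R θ) * circleMap c R θ‖ ≤ |B| :=
      (hB _ (hm θ)).trans (le_abs_self B)
    rw [norm_smul, deriv_circleMap, norm_mul, norm_circleMap_zero, norm_I, mul_one, abs_of_pos hR]
    gcongr
    calc _ = ‖F (circleMap c R θ) * circleMap c R θ‖ * ‖exp (-circleMap c R θ * (v : ℝ))‖ := by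
          simp only [norm_mul, norm_neg]; ring
      _ ≤ _ := by gcongr
  · exact intervalIntegrable_const
  · refine Eventually.of_forall fun θ _ v _ => ?_
    have h1 : HasDerivAt (fun v : ℝ => -circleMap c R θ * (v : ℂ)) (-circleMap c R θ) v := by
      simpa using (Complex.ofRealCLM.hasDerivAt (x := v)).const_mul (-circleMap c R θ)
    exact (h1.cexp.const_mul (F (circleMap c R θ))).const_mul (deriv (circleMap c R) θ)

theorem differentiableOn_residualIntegral {F : ℂ → ℂ} {c : ℂ} {R : ℝ} (hR : 0 < R)
    (hF : ContinuousOn F (Metric.sphere c R)) :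
    DifferentiableOn ℝ (residualIntegral F c R) (Ioi 0) := by
  intro x hx
  have hx : 0 < x := hx
  apply DifferentiableAt.differentiableWithinAt
  have h1 := (DifferentiableAt.comp x (differentiableAt_circleIntegral_mul_exp hR hF (Real.log x))
    (Real.differentiableAt_log hx.ne')).const_mul (2 * Real.pi * I : ℂ)⁻¹
  refine h1.congr_of_eventuallyEq ?_
  filter_upwards [lt_mem_nhds hx] with y hy
  simp only [residualIntegral, Function.comp]
  congr 1
  refine circleIntegral.integral_congr hR.le fun s _ => ?_
  rw [cpow_def_of_ne_zero (by exact_mod_cast hy.ne'), ofReal_log hy.le]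
  ring_nf

theorem norm_ofReal_cpow_neg_le {x : ℝ} (hx : 0 < x) {w : ℂ} {k : ℝ} (hw : |w.re| ≤ k) :
    (x ≤ 1 → ‖(x : ℂ) ^ (-w)‖ ≤ x ^ (-k)) ∧ (1 ≤ x → ‖(x : ℂ) ^ (-w)‖ ≤ x ^ k) := by
  rw [norm_ofReal_cpow_neg hx]
  obtain ⟨h1, h2⟩ := abs_le.1 hw
  exact ⟨fun h => Real.rpow_le_rpow_of_exponent_ge hx h (by linarith),
    fun h => Real.rpow_le_rpow_of_exponent_le h (by linarith)⟩

theorem abs_re_le_of_mem_sphere {c w : ℂ} {R : ℝ} (hw : w ∈ Metric.sphere c R) :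
    |w.re| ≤ ‖c‖ + R := by
  have := norm_sub_norm_le w c
  rw [← dist_eq_norm, Metric.mem_sphere.1 hw] at this
  linarith [abs_re_le_norm w]

theorem residualIntegral_growth {F : ℂ → ℂ} {c : ℂ} {R : ℝ} (hR : 0 < R)
    (hF : ContinuousOn F (Metric.sphere c R)) :
    residualIntegral F c R =O[𝓝[>] (0 : ℝ)] (fun x => x ^ (-(‖c‖ + R))) ∧
      residualIntegral F c R =O[atTop] (fun x => x ^ (‖c‖ + R)) := by
  obtain ⟨B, hB⟩ := (isCompact_sphere c R).exists_bound_of_continuousOn hF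
  have key : ∀ x y : ℝ, 0 ≤ y → (∀ w ∈ Metric.sphere c R, ‖(x : ℂ) ^ (-w)‖ ≤ y) →
      ‖residualIntegral F c R x‖ ≤ R * |B| * ‖y‖ := by
    intro x y hy h
    rw [Real.norm_of_nonneg hy, mul_assoc]
    refine circleIntegral.norm_two_pi_i_inv_smul_integral_le_of_norm_le_const hR.le fun w hw => ?_
    rw [norm_mul]
    exact mul_le_mul ((hB w hw).trans (le_abs_self B)) (h w hw) (norm_nonneg _) (abs_nonneg B)
  constructor
  · refine IsBigO.of_bound (R * |B|) ?_
    filter_upwards [Ioc_mem_nhdsGT (zero_lt_one' ℝ)] with x hx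
    exact key x _ (Real.rpow_nonneg hx.1.le _) fun w hw =>
      (norm_ofReal_cpow_neg_le hx.1 (abs_re_le_of_mem_sphere hw)).1 hx.2
  · refine IsBigO.of_bound (R * |B|) ?_
    filter_upwards [eventually_ge_atTop 1] with x hx
    have hx0 : 0 < x := by linarith
    exact key x _ (Real.rpow_nonneg hx0.le _) fun w hw =>
      (norm_ofReal_cpow_neg_le hx0 (abs_re_le_of_mem_sphere hw)).2 hx

/-- Fubini on circle times `A`, with `D` dominating uniformly on the circle; it serves both Mellin
integrals, over `(0, 1]` and over `(1, ∞)`. -/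
theorem integral_residualIntegral_mul_cpow {F : ℂ → ℂ} {c : ℂ} {R : ℝ} (hR : 0 < R)
    (hF : ContinuousOn F (Metric.sphere c R)) {A : Set ℝ} (hA : MeasurableSet A)
    (hA0 : A ⊆ Ioi 0) {D : ℝ → ℝ} (hD : IntegrableOn D A) (s : ℂ)
    (hDs : ∀ x ∈ A, ∀ w ∈ Metric.sphere c R, ‖(x : ℂ) ^ (-w) * (x : ℂ) ^ (s - 1)‖ ≤ D x) :
    IntegrableOn (fun x : ℝ => residualIntegral F c R x * (x : ℂ) ^ (s - 1)) A ∧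
      (∫ x in A, residualIntegral F c R x * (x : ℂ) ^ (s - 1)) =
        (2 * Real.pi * I : ℂ)⁻¹ * ∮ w in C(c, R), (∫ x in A, (x : ℂ) ^ (s - w - 1)) * F w := by
  have hm : ∀ θ, circleMap c R θ ∈ Metric.sphere c R := circleMap_mem_sphere c hR.le
  obtain ⟨B, hB⟩ := (isCompact_sphere c R).exists_bound_of_continuousOn hF
  set G : ℝ → ℝ → ℂ := fun θ x => deriv (circleMap c R) θ •
    (F (circleMap c R θ) * ((x : ℂ) ^ (-circleMap c R θ) * (x : ℂ) ^ (s - 1))) with hG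
  have hGc : ContinuousOn G.uncurry (uIoc 0 (2 * Real.pi) ×ˢ A) := by
    simp only [hG, Function.uncurry_def, deriv_circleMap]
    have c0 : Continuous fun p : ℝ × ℝ => circleMap c R p.1 :=
      (continuous_circleMap c R).comp continuous_fst
    have c1 : Continuous fun p : ℝ × ℝ => circleMap 0 R p.1 * I :=
      ((continuous_circleMap 0 R).comp continuous_fst).mul continuous_const
    have c2 : Continuous fun p : ℝ × ℝ => F (circleMap c R p.1) :=
      hF.comp_continuous c0 fun p => hm p.1
    have c3 : Continuous fun p : ℝ × ℝ => (p.2 : ℂ) := by fun_prop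
    have hs : ∀ p ∈ uIoc 0 (2 * Real.pi) ×ˢ A, (p.2 : ℂ) ∈ slitPlane := fun p hp =>
      ofReal_mem_slitPlane.2 (hA0 hp.2)
    exact c1.continuousOn.smul (c2.continuousOn.mul
      ((c3.continuousOn.cpow c0.neg.continuousOn hs).mul
        (c3.continuousOn.cpow continuousOn_const hs)))
  have : IsFiniteMeasure (volume.restrict (uIoc 0 (2 * Real.pi))) := by
    rw [uIoc_of_le Real.two_pi_pos.le]; infer_instance
  have hGi : Integrable G.uncurry
      ((volume.restrict (uIoc 0 (2 * Real.pi))).prod (volume.restrict A)) := by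
    have h1 : Integrable (fun p : ℝ × ℝ => R * |B| * D p.2)
        ((volume.restrict (uIoc 0 (2 * Real.pi))).prod (volume.restrict A)) :=
      (Integrable.comp_snd (f := D) hD _).const_mul (R * |B|)
    refine h1.mono' ?_ ?_
    · rw [Measure.prod_restrict]
      exact hGc.aestronglyMeasurable (measurableSet_uIoc.prod hA)
    · rw [Measure.prod_restrict]
      refine (ae_restrict_iff' (measurableSet_uIoc.prod hA)).2 (Eventually.of_forall ?_)
      rintro ⟨θ, x⟩ hp
      simp only [hG, Function.uncurry_apply_pair]
      rw [norm_smul, deriv_circleMap, norm_mul, norm_circleMap_zero, norm_I, mul_one,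
        abs_of_pos hR, norm_mul, mul_assoc]
      gcongr
      · exact (hB _ (hm θ)).trans (le_abs_self B)
      · exact hDs x hp.2 _ (hm θ)
  have e1 : ∀ x, residualIntegral F c R x * (x : ℂ) ^ (s - 1) =
      (2 * Real.pi * I : ℂ)⁻¹ * ∫ θ in (0)..(2 * Real.pi), G θ x := fun x => by
    simp only [residualIntegral, circleIntegral, hG, mul_assoc]
    rw [← intervalIntegral.integral_mul_const]
    congr 1
    refine intervalIntegral.integral_congr fun θ _ => ?_
    simp only [smul_eq_mul]
    ring
  simp only [e1]
  constructor
  · refine Integrable.const_mul ?_ _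
    refine hGi.integral_prod_right.congr (Eventually.of_forall fun x => ?_)
    simp only [Function.uncurry_apply_pair]
    rw [intervalIntegral.integral_of_le Real.two_pi_pos.le, uIoc_of_le Real.two_pi_pos.le]
  · rw [integral_const_mul, ← intervalIntegral_integral_swap hGi]
    congr 1
    simp only [circleIntegral]
    refine intervalIntegral.integral_congr fun θ _ => ?_
    simp only [hG, smul_eq_mul]
    rw [integral_const_mul, integral_const_mul, mul_comm (F _)]
    congr 2
    refine setIntegral_congr_fun hA fun x hx => ?_
    have hx0 : (x : ℂ) ≠ 0 := by exact_mod_cast (hA0 hx : 0 < x).ne'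
    rw [← cpow_add _ _ hx0]
    congr 1
    ring

theorem integral_Ioc_residualIntegral {F : ℂ → ℂ} {c : ℂ} {R : ℝ} (hR : 0 < R)
    (hF : ContinuousOn F (Metric.sphere c R)) {s : ℂ} (hs : ‖c‖ + R < s.re) :
    IntegrableOn (fun x : ℝ => residualIntegral F c R x * (x : ℂ) ^ (s - 1)) (Ioc 0 1) ∧
      (∫ x in Ioc (0 : ℝ) 1, residualIntegral F c R x * (x : ℂ) ^ (s - 1)) =
        principalPart F c R s := by
  obtain ⟨h1, h2⟩ := integral_residualIntegral_mul_cpow hR hF (A := Ioc 0 1) measurableSet_Ioc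
    Ioc_subset_Ioi_self (D := fun x => x ^ (-(‖c‖ + R) + (s.re - 1))) (by
      rw [← intervalIntegrable_iff_integrableOn_Ioc_of_le zero_le_one]
      exact intervalIntegral.intervalIntegrable_rpow' (by linarith)) s (by
      intro x hx w hw
      rw [norm_mul, Real.rpow_add hx.1, norm_cpow_eq_rpow_re_of_pos hx.1 (s - 1), sub_re, one_re]
      gcongr
      · exact Real.rpow_nonneg hx.1.le _
      · exact (norm_ofReal_cpow_neg_le hx.1 (abs_re_le_of_mem_sphere hw)).1 hx.2)
  refine ⟨h1, h2.trans ?_⟩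
  rw [principalPart]
  congr 1
  refine circleIntegral.integral_congr hR.le fun w hw => ?_
  have h3 := (abs_le.1 (abs_re_le_of_mem_sphere hw)).2
  have h4 : s - w ≠ 0 := fun h => by
    have := congrArg re h
    simp at this
    linarith
  rw [← intervalIntegral.integral_of_le zero_le_one, integral_cpow (.inl (by simp; linarith))]
  simp [zero_cpow h4]

theorem integral_Ioi_residualIntegral {F : ℂ → ℂ} {c : ℂ} {R : ℝ} (hR : 0 < R)
    (hF : ContinuousOn F (Metric.sphere c R)) {s : ℂ} (hs : s.re < -(‖c‖ + R)) :
    IntegrableOn (fun x : ℝ => residualIntegral F c R x * (x : ℂ) ^ (s - 1)) (Ioi 1) ∧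
      -(∫ x in Ioi (1 : ℝ), residualIntegral F c R x * (x : ℂ) ^ (s - 1)) =
        principalPart F c R s := by
  obtain ⟨h1, h2⟩ := integral_residualIntegral_mul_cpow hR hF (A := Ioi 1) measurableSet_Ioi
    (Ioi_subset_Ioi zero_le_one) (D := fun x => x ^ ((‖c‖ + R) + (s.re - 1)))
      (integrableOn_Ioi_rpow_of_lt (by linarith) one_pos) s (by
      intro x hx w hw
      have hx1 : 1 < x := hx
      have hx0 : 0 < x := by linarith
      rw [norm_mul, Real.rpow_add hx0, norm_cpow_eq_rpow_re_of_pos hx0 (s - 1), sub_re, one_re]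
      gcongr
      exact (norm_ofReal_cpow_neg_le hx0 (abs_re_le_of_mem_sphere hw)).2 hx1.le)
  refine ⟨h1, ?_⟩
  rw [h2, principalPart, ← mul_neg, ← neg_one_mul, ← circleIntegral.integral_const_mul]
  congr 1
  refine circleIntegral.integral_congr hR.le fun w hw => ?_
  have h3 := (abs_le.1 (abs_re_le_of_mem_sphere hw)).1
  rw [integral_Ioi_cpow_of_lt (by simp; linarith) one_pos]
  simp
  ring

theorem isResidualFunction_residualIntegral {S : Set ℂ} (hS : IsCompact S) {F : ℂ → ℂ}
    (hF : AnalyticOnNhd ℂ F Sᶜ) {c : ℂ} {R : ℝ} (hC : CircleEnclosesSingularities S F c R) :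
    IsResidualFunction S (residualIntegral F c R) := by
  obtain ⟨hR, hsph, g, hg, hgF⟩ := hC
  have hFc : ContinuousOn F (Metric.sphere c R) := hF.continuousOn.mono hsph
  have hgd : ∀ z, R ≤ dist z c → DifferentiableAt ℂ g z := fun z hz => by
    refine (hg z ?_).differentiableAt
    rcases hz.eq_or_lt with h | h
    · exact .inl (hsph h.symm)
    · exact .inr (by simpa using h)
  obtain ⟨E, hE, hgE⟩ := exists_entire_add_principalPart hR hgd
  have hpp : principalPart g c R = principalPart F c R := funext fun s => by
    simp only [principalPart]
    congr 1
    refine circleIntegral.integral_congr hR.le fun w hw => ?_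
    simp only [hgF (hsph hw)]
  obtain ⟨K, hK⟩ := hS.isBounded.exists_norm_le
  have hJ : ∀ s, K < ‖s‖ → ‖c‖ + R < ‖s‖ → F s - E s = principalPart F c R s := by
    intro s h1 h2
    have h3 : R < dist s c := by
      rw [dist_eq_norm]; linarith [norm_sub_norm_le s c]
    rw [← hgF (fun h => h1.not_ge (hK s h) : s ∈ Sᶜ), hgE s h3, hpp]
    ring
  -- The continuation is `F - E` and not the principal part itself, because `Sᶜ` may contain points
  -- inside the circle, where the Cauchy integral no longer represents the continuation.
  refine ⟨differentiableOn_residualIntegral hR hFc, ⟨‖c‖ + R, by positivity,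
    residualIntegral_growth hR hFc⟩, fun s => F s - E s,
    hF.sub fun z _ => hE.analyticAt z, ⟨max K (‖c‖ + R), fun s hs => ?_⟩,
    ⟨-max K (‖c‖ + R), fun s hs => ?_⟩, fun σ₁ σ₂ _ => ?_⟩
  · have h1 := integral_Ioc_residualIntegral hR hFc ((le_max_right _ _).trans_lt hs)
    have h2 := hs.trans_le (re_le_norm s)
    rw [max_lt_iff] at h2
    exact ⟨h1.1, (hJ s h2.1 h2.2).trans h1.2.symm⟩
  · have h1 := integral_Ioi_residualIntegral hR hFc
      (hs.trans_le (neg_le_neg (le_max_right K (‖c‖ + R))))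
    have h2 : max K (‖c‖ + R) < ‖s‖ := by
      linarith [neg_abs_le s.re, abs_re_le_norm s]
    rw [max_lt_iff] at h2
    exact ⟨h1.1, (hJ s h2.1 h2.2).trans h1.2.symm⟩
  -- The principal part tends to zero in every direction, so the strip plays no role.
  · refine Tendsto.mono_left ?_ inf_le_left
    obtain ⟨M, hM0, hM⟩ := norm_principalPart_le hR hFc
    have hfar := tendsto_norm_cobounded_atTop (E := ℂ)
    have ht : Tendsto (fun s : ℂ => M / (‖s‖ - (‖c‖ + R))) (Bornology.cobounded ℂ) (𝓝 0) :=
      tendsto_const_nhds.div_atTop (tendsto_atTop_add_const_right _ _ hfar)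
    refine squeeze_zero_norm' ?_ ht
    filter_upwards [hfar.eventually_gt_atTop K, hfar.eventually_gt_atTop (‖c‖ + R)] with s h1 h2
    have h3 : ‖s‖ - ‖c‖ ≤ dist s c := by
      rw [dist_eq_norm]; exact norm_sub_norm_le s c
    rw [hJ s h1 h2]
    refine (hM s (by linarith)).trans ?_
    exact div_le_div_of_nonneg_left hM0 (by linarith) (by linarith)

/-! ### The functional equation and the shift of the contour. -/

section FunctionalEquation

variable {r : ℕ} {a b : ℕ → ℂ} {lam mu : ℕ → ℝ} {σa σb : ℝ} {α : Fin r → ℝ} {β : Fin r → ℂ}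
  {Q δ : ℝ} {ω : ℂ} {S : Set ℂ} {χ : ℂ → ℂ}

/-- Positivity of `s.re` keeps `s` off the Gamma poles, where `eq_right` asserts nothing. -/
theorem FunctionalEquation.continuedF_of_re_gt
    (hFE : FunctionalEquation a lam σa b mu σb α β Q δ ω S χ) (hQ : 0 < Q)
    (hα : ∀ i, 0 < α i) (hβ : ∀ i, 0 ≤ (β i).re) {s : ℂ} (hsS : s ∈ Sᶜ) (hs : σa < s.re)
    (hs0 : 0 < s.re) : continuedF Q χ s = completedSeries a lam α β s := by
  have hQ0 : (Q : ℂ) ≠ 0 := by exact_mod_cast hQ.ne'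
  rw [continuedF, hFE.eq_right s hsS hs (not_isGammaPole hα hβ hs0), ← mul_assoc,
    ← cpow_add _ _ hQ0]
  simp

theorem FunctionalEquation.continuedF_of_re_lt
    (hFE : FunctionalEquation a lam σa b mu σb α β Q δ ω S χ) (hQ : 0 < Q)
    (hmu : ∀ n, 0 < mu n) (hα : ∀ i, 0 < α i) (hβ : ∀ i, 0 ≤ (β i).re) {s : ℂ} (hsS : s ∈ Sᶜ)
    (hs : s.re < δ - σb) (hs0 : s.re < δ) :
    continuedF Q χ s = ω * (Q : ℂ) ^ ((δ : ℂ) - 2 * s) *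
      completedSeries (fun n => (starRingEnd ℂ) (b n)) mu α (fun i => (starRingEnd ℂ) (β i))
        (δ - s) := by
  have hQ0 : (Q : ℂ) ≠ 0 := by exact_mod_cast hQ.ne'
  rw [continuedF, hFE.eq_left s hsS hs (not_isGammaPole hα hβ (by simpa using hs0)),
    conj_completedSeries hmu]
  simp only [map_sub, conj_ofReal, conj_conj]
  rw [show (δ : ℂ) - 2 * s = -s + (δ - s) by ring, cpow_add _ _ hQ0]
  ring

theorem analyticOnNhd_continuedF (hQ : 0 < Q) (hχ : AnalyticOnNhd ℂ χ Sᶜ) :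
    AnalyticOnNhd ℂ (continuedF Q χ) Sᶜ :=
  AnalyticOnNhd.mul (fun z _ => (differentiable_ofReal_cpow_neg hQ).analyticAt z) hχ

theorem continuedF_isBigO {σ₁ σ₂ : ℝ} (hQ : 0 < Q) {B : ℂ → ℝ}
    (h : χ =O[Bornology.cobounded ℂ ⊓ 𝓟 {s : ℂ | σ₁ ≤ s.re ∧ s.re ≤ σ₂}] B) :
    continuedF Q χ =O[Bornology.cobounded ℂ ⊓ 𝓟 {s : ℂ | σ₁ ≤ s.re ∧ s.re ≤ σ₂}] B := by
  have hX : ContinuousOn (fun y : ℝ => Q ^ (-y)) (Icc σ₁ σ₂) :=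
    ((Real.continuous_const_rpow hQ.ne').comp continuous_neg).continuousOn
  obtain ⟨X, hX⟩ := isCompact_Icc.exists_bound_of_continuousOn hX
  have h1 : (fun s : ℂ => (Q : ℂ) ^ (-s))
      =O[Bornology.cobounded ℂ ⊓ 𝓟 {s : ℂ | σ₁ ≤ s.re ∧ s.re ≤ σ₂}] fun _ => (1 : ℝ) := by
    refine IsBigO.of_bound X ?_
    filter_upwards [mem_inf_of_right (mem_principal_self _)] with s hs
    rw [norm_ofReal_cpow_neg hQ, norm_one, mul_one]
    exact (le_abs_self _).trans (hX s.re hs)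
  exact (h1.mul h).congr_right fun s => one_mul _

theorem sq_norm_sub_le (c z : ℂ) :
    ‖(z - c) ^ 2‖ ≤ (|z.re| + ‖c‖ + 1) ^ 2 * (1 + |z.im|) ^ 2 := by
  rw [norm_pow, ← mul_pow]
  gcongr
  have h1 := norm_sub_le z c
  have h2 := norm_le_abs_re_add_abs_im z
  nlinarith [abs_nonneg z.im, abs_nonneg z.re, norm_nonneg c,
    mul_nonneg (add_nonneg (abs_nonneg z.re) (norm_nonneg c)) (abs_nonneg z.im)]

/-- The powers of the functional equation, at `s = δ - u`. -/
theorem cpow_reflect_mul {x : ℝ} (hx : 0 < x) (hQ : 0 < Q) (δ : ℝ) (u : ℂ) :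
    (x : ℂ) ^ (-((δ : ℂ) - u)) * (Q : ℂ) ^ ((δ : ℂ) - 2 * (δ - u)) =
      ((((x * Q) ^ δ : ℝ) : ℂ))⁻¹ * (((1 / (Q ^ 2 * x) : ℝ)) : ℂ) ^ (-u) := by
  have hx0 : (x : ℂ) ≠ 0 := by exact_mod_cast hx.ne'
  have hQ0 : (Q : ℂ) ≠ 0 := by exact_mod_cast hQ.ne'
  have hy : 0 < 1 / (Q ^ 2 * x) := by positivity
  have hy0 : ((1 / (Q ^ 2 * x) : ℝ) : ℂ) ≠ 0 := by exact_mod_cast hy.ne'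
  have hl : Real.log (1 / (Q ^ 2 * x)) = -(2 * Real.log Q + Real.log x) := by
    rw [one_div, Real.log_inv, Real.log_mul (by positivity) hx.ne', Real.log_pow]
    norm_num
  rw [cpow_def_of_ne_zero hx0, cpow_def_of_ne_zero hQ0, cpow_def_of_ne_zero hy0,
    Real.rpow_def_of_pos (mul_pos hx hQ), Real.log_mul hx.ne' hQ.ne', ← ofReal_log hx.le,
    ← ofReal_log hQ.le, ← ofReal_log hy.le, hl, ofReal_exp, ← Complex.exp_neg, ← Complex.exp_add,
    ← Complex.exp_add]
  congr 1
  push_cast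
  ring

theorem FunctionalEquation.mellinInv_eq (hr : 0 < r) (hφ : IsDirichletSeries a lam σa)
    (hψ : IsDirichletSeries b mu σb) (hα : ∀ i, 0 < α i) (hβ : ∀ i, 0 ≤ (β i).re)
    (hQ : 0 < Q) (hδ : 0 < δ)
    (hFE : FunctionalEquation a lam σa b mu σb α β Q δ ω S χ) {c : ℂ} {R : ℝ}
    (hC : CircleEnclosesSingularities S (continuedF Q χ) c R) :
    ∃ κ : ℝ, 0 < κ ∧ σa < κ ∧ σb < δ + κ ∧ ∀ x : ℝ, 0 < x →
      mellinInv κ (completedSeries a lam α β) x =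
        residualIntegral (continuedF Q χ) c R x + ω / (((x * Q) ^ δ : ℝ) : ℂ) *
          mellinInv (δ + κ) (completedSeries (fun n => (starRingEnd ℂ) (b n)) mu α
            (fun i => (starRingEnd ℂ) (β i))) (1 / (Q ^ 2 * x)) := by
  obtain ⟨hR, hsph, g, hg, hgF⟩ := hC
  obtain ⟨L, hL⟩ := hFE.isCompact.isBounded.exists_norm_le
  -- Large enough that the lines `Re s = ±κ` miss `S`, lie in the two half-planes of absolute
  -- convergence, and enclose the disc with the margin one used in the Phragmén–Lindelöf bound.
  obtain ⟨κ, hκ⟩ : ∃ κ : ℝ, κ = |L| + |σa| + |σb| + ‖c‖ + R + 1 := ⟨_, rfl⟩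
  have hL0 := le_abs_self L
  have hL1 := abs_nonneg L
  have ha0 := le_abs_self σa
  have ha1 := abs_nonneg σa
  have hb0 := le_abs_self σb
  have hb1 := abs_nonneg σb
  have hc0 := abs_le.1 (abs_re_le_norm c)
  have hc1 := norm_nonneg c
  have hκ0 : 0 < κ := by linarith
  have hσa : σa < κ := by linarith
  have hσb : σb < δ + κ := by linarith
  refine ⟨κ, hκ0, hσa, hσb, ?_⟩
  have hβ' : ∀ i, 0 ≤ ((starRingEnd ℂ) (β i)).re := fun i => by simpa using hβ i
  have hgd : ∀ z, R ≤ dist z c → DifferentiableAt ℂ g z := fun z hz => by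
    refine (hg z ?_).differentiableAt
    rcases hz.eq_or_lt with h | h
    · exact .inl (hsph h.symm)
    · exact .inr (by simpa using h)
  have hmem : ∀ s : ℂ, L < ‖s‖ → s ∈ Sᶜ := fun s hs h => hs.not_ge (hL s h)
  have hgr : ∀ s : ℂ, s.re = κ → g s = completedSeries a lam α β s := fun s hs => by
    have hsS := hmem s ((show L < s.re by linarith).trans_le (re_le_norm s))
    rw [hgF hsS]
    exact hFE.continuedF_of_re_gt hQ hα hβ hsS (by linarith) (by linarith)
  have hgl : ∀ s : ℂ, s.re = -κ → g s = ω * (Q : ℂ) ^ ((δ : ℂ) - 2 * s) *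
      completedSeries (fun n => (starRingEnd ℂ) (b n)) mu α (fun i => (starRingEnd ℂ) (β i))
        (δ - s) := fun s hs => by
    have hsS := hmem s (by linarith [neg_abs_le s.re, abs_re_le_norm s])
    rw [hgF hsS]
    exact hFE.continuedF_of_re_lt hQ hψ.pos hα hβ hsS (by linarith) (by linarith)
  obtain ⟨M₁, hM₁0, hM₁⟩ := hφ.exists_completedSeries_bound hr hα hβ hσa hκ0
  obtain ⟨M₂, hM₂0, hM₂⟩ := hψ.star.exists_completedSeries_bound hr hα hβ' hσb
    (by linarith : 0 < δ + κ)
  have hbr : ∀ s : ℂ, s.re = κ → (1 + |s.im|) ^ 2 * ‖g s‖ ≤ M₁ := fun s hs => by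
    rw [hgr s hs]; exact hM₁ s hs
  have hbl : ∀ s : ℂ, s.re = -κ → (1 + |s.im|) ^ 2 * ‖g s‖ ≤ ‖ω‖ * Q ^ (δ + 2 * κ) * M₂ := by
    intro s hs
    have h1 := hM₂ (δ - s) (by simp [hs])
    have h2 : ‖(Q : ℂ) ^ ((δ : ℂ) - 2 * s)‖ = Q ^ (δ + 2 * κ) := by
      rw [norm_cpow_eq_rpow_re_of_pos hQ]; simp [hs]
    rw [hgl s hs, norm_mul, norm_mul, h2, mul_left_comm]
    gcongr
    simpa using h1
  obtain ⟨θ, hθ, hgrowth⟩ := hFE.growth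
  have hgO : g =O[Bornology.cobounded ℂ ⊓ 𝓟 {s : ℂ | -κ ≤ s.re ∧ s.re ≤ κ}]
      fun s => Real.exp (Real.exp (θ * Real.pi * ‖s‖ / (κ - -κ))) := by
    refine (continuedF_isBigO hQ (hgrowth (-κ) κ (by linarith))).congr' ?_ EventuallyEq.rfl
    have h1 : ∀ᶠ s : ℂ in Bornology.cobounded ℂ, L < ‖s‖ :=
      tendsto_norm_cobounded_atTop.eventually_gt_atTop L
    filter_upwards [h1.filter_mono inf_le_left] with s hs using (hgF (hmem s hs)).symm
  set M : ℝ := max M₁ (‖ω‖ * Q ^ (δ + 2 * κ) * M₂) with hM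
  have hline : ∀ z : ℂ, |z.re| = κ → (1 + |z.im|) ^ 2 * ‖g z‖ ≤ M →
      ‖(z - c) ^ 2 * g z‖ ≤ (κ + ‖c‖ + 1) ^ 2 * M := fun z hz hb => by
    rw [norm_mul]
    calc ‖(z - c) ^ 2‖ * ‖g z‖ ≤ (|z.re| + ‖c‖ + 1) ^ 2 * (1 + |z.im|) ^ 2 * ‖g z‖ := by
          gcongr; exact sq_norm_sub_le c z
      _ = (κ + ‖c‖ + 1) ^ 2 * ((1 + |z.im|) ^ 2 * ‖g z‖) := by rw [hz, mul_assoc]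
      _ ≤ _ := by gcongr
  obtain ⟨N, hN⟩ := sq_mul_norm_bounded_of_isBigO hR hgd (a := -κ) (b := κ) (by linarith)
    (by linarith) hθ hgO
    (fun z hz => hline z (by rw [hz, abs_neg, abs_of_pos hκ0])
      ((hbl z hz).trans (le_max_right _ _)))
    (fun z hz => hline z (by rw [hz, abs_of_pos hκ0]) ((hbr z hz).trans (le_max_left _ _)))
  intro x hx
  have hX : ContinuousOn (fun y : ℝ => x ^ (-y)) (Icc (-κ) κ) :=
    ((Real.continuous_const_rpow hx.ne').comp continuous_neg).continuousOn
  obtain ⟨X, hX⟩ := isCompact_Icc.exists_bound_of_continuousOn hX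
  have hX' : ∀ z : ℂ, -κ ≤ z.re → z.re ≤ κ → ‖(x : ℂ) ^ (-z)‖ ≤ |X| := fun z h1 h2 => by
    rw [norm_ofReal_cpow_neg hx]
    exact (le_abs_self _).trans ((hX z.re ⟨h1, h2⟩).trans (le_abs_self X))
  have hfd : ∀ z, R ≤ dist z c → DifferentiableAt ℂ (fun s => (x : ℂ) ^ (-s) * g s) z :=
    fun z hz => (differentiable_ofReal_cpow_neg hx z).mul (hgd z hz)
  have hint : ∀ τ : ℝ, |τ| = κ → (∀ z : ℂ, z.re = τ → (1 + |z.im|) ^ 2 * ‖g z‖ ≤ M) →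
      Integrable fun y : ℝ => (x : ℂ) ^ (-((τ : ℂ) + y * I)) * g (τ + y * I) := by
    intro τ hτ hb
    refine integrable_of_sq_mul_le (M := |X| * M) ?_ fun y => ?_
    · rw [continuous_iff_continuousAt]
      intro y
      refine ContinuousAt.comp (f := fun y : ℝ => (τ : ℂ) + y * I)
        (hfd (τ + y * I) ?_).continuousAt (by fun_prop)
      have h1 : |τ| ≤ ‖(τ : ℂ) + y * I‖ := by simpa using abs_re_le_norm ((τ : ℂ) + y * I)
      rw [dist_eq_norm]
      linarith [norm_sub_norm_le ((τ : ℂ) + y * I) c]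
    · obtain ⟨h1, h2⟩ := abs_le.1 hτ.le
      rw [norm_mul, mul_left_comm]
      gcongr
      · exact hX' _ (by simpa using h1) (by simpa using h2)
      · simpa using hb (τ + y * I) (by simp)
  -- For `|z.im| ≥ T₀` one has both `dist z c ≥ R + 1` and `‖z - c‖ ≥ |z.im| / 2`. The latter
  -- converts decay in `z - c` into decay in `z.im`, at the cost of the factor `4`.
  have key := integral_vertical_sub_of_rectIntegral_eq (f := fun s => (x : ℂ) ^ (-s) * g s)
    (a := -κ) (b := κ) (T₀ := 2 * |c.im| + R + 1) (M := |X| * (4 * N)) (by linarith)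
    (fun T hT => rectIntegral_eq_circleIntegral hR hfd (by linarith) (by linarith)
      (by linarith [abs_nonneg c.im]))
    (hint (-κ) (by rw [abs_neg, abs_of_pos hκ0])
      fun z hz => (hbl z hz).trans (le_max_right _ _))
    (hint κ (abs_of_pos hκ0) fun z hz => (hbr z hz).trans (le_max_left _ _))
    (fun z h1 h2 h3 => by
      have hc2 := abs_nonneg c.im
      have h4 : |z.im| / 2 ≤ ‖z - c‖ := by
        have h5 := abs_im_le_norm (z - c)
        rw [sub_im] at h5
        linarith [abs_sub_abs_le_abs_sub z.im c.im]
      have h6 : 0 < |z.im| := by linarith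
      have h7 := hN z h1 h2 (by
        have h5 := abs_im_le_norm (z - c)
        rw [sub_im] at h5
        rw [dist_eq_norm]
        linarith [abs_sub_abs_le_abs_sub z.im c.im])
      rw [norm_mul, norm_pow] at h7
      rw [norm_mul, mul_div_assoc]
      refine mul_le_mul (hX' z h1 h2) ?_ (norm_nonneg _) (abs_nonneg X)
      rw [← sq_abs, le_div_iff₀ (by positivity)]
      have h8 : (|z.im| / 2) ^ 2 * ‖g z‖ ≤ ‖z - c‖ ^ 2 * ‖g z‖ := by gcongr
      nlinarith)
  have e1 : (∫ y : ℝ, (x : ℂ) ^ (-((κ : ℂ) + y * I)) * g (κ + y * I)) =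
      ∫ y : ℝ, (x : ℂ) ^ (-((κ : ℂ) + y * I)) • completedSeries a lam α β (κ + y * I) := by
    refine integral_congr_ae (Eventually.of_forall fun y => ?_)
    simp only [smul_eq_mul]
    rw [hgr _ (by simp)]
  have e2 : (∫ y : ℝ, (x : ℂ) ^ (-(((-κ : ℝ) : ℂ) + y * I)) * g (((-κ : ℝ) : ℂ) + y * I)) =
      ω / (((x * Q) ^ δ : ℝ) : ℂ) *
        ∫ y : ℝ, ((1 / (Q ^ 2 * x) : ℝ) : ℂ) ^ (-(((δ + κ : ℝ) : ℂ) + y * I)) •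
          completedSeries (fun n => (starRingEnd ℂ) (b n)) mu α (fun i => (starRingEnd ℂ) (β i))
            (((δ + κ : ℝ) : ℂ) + y * I) := by
    -- The reflection `s ↦ δ - s` maps the line `-κ` to `δ + κ` and reverses it, hence `y ↦ -y`.
    rw [← integral_neg_eq_self, ← integral_const_mul]
    refine integral_congr_ae (Eventually.of_forall fun y => ?_)
    have hu : (((-κ : ℝ) : ℂ) + ((-y : ℝ) : ℂ) * I) = δ - (((δ + κ : ℝ) : ℂ) + y * I) := by
      push_cast; ring
    simp only [smul_eq_mul]
    rw [hgl _ (by simp), hu, sub_sub_cancel]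
    have h1 := cpow_reflect_mul hx hQ δ (((δ + κ : ℝ) : ℂ) + y * I)
    rw [div_eq_mul_inv]
    linear_combination ω * completedSeries (fun n => (starRingEnd ℂ) (b n)) mu α
      (fun i => (starRingEnd ℂ) (β i)) (((δ + κ : ℝ) : ℂ) + y * I) * h1
  have e3 : (∮ s in C(c, R), (x : ℂ) ^ (-s) * g s) =
      ∮ s in C(c, R), continuedF Q χ s * (x : ℂ) ^ (-s) :=
    circleIntegral.integral_congr hR.le fun s hs => by
      simp only [hgF (hsph hs), mul_comm]
  rw [e1, e2, e3] at key
  have hpi : (Real.pi : ℂ) ≠ 0 := by exact_mod_cast Real.pi_ne_zero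
  have hcomb : ∀ U V k : ℂ, ((1 / (2 * Real.pi) : ℝ) : ℂ) * U =
      (2 * Real.pi * I : ℂ)⁻¹ * (I * U - I * (k * V)) +
        k * (((1 / (2 * Real.pi) : ℝ) : ℂ) * V) := fun U V k => by
    push_cast
    field_simp [I_ne_zero]
    ring
  simp only [mellinInv, residualIntegral, ← key, real_smul]
  exact hcomb _ _ _

end FunctionalEquation

/-! ### The modular relation. -/

theorem theorem1p1 {r : ℕ} (hr : 0 < r)
    (a b : ℕ → ℂ) (lam mu : ℕ → ℝ) (σa σb : ℝ)
    (hφ : IsDirichletSeries a lam σa) (hψ : IsDirichletSeries b mu σb)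
    (α : Fin r → ℝ) (hα : ∀ i, 0 < α i) (β : Fin r → ℂ) (hβ : ∀ i, 0 ≤ (β i).re)
    (Q δ : ℝ) (hQ : 0 < Q) (hδ : 0 < δ) (ω : ℂ) (hω : ‖ω‖ = 1)
    (S : Set ℂ) (χ : ℂ → ℂ)
    (hFE : FunctionalEquation a lam σa b mu σb α β Q δ ω S χ)
    (c : ℂ) (R : ℝ) (hC : CircleEnclosesSingularities S (continuedF Q χ) c R)
    (κ : ℝ) (hκ : 0 < κ) :
    IsResidualFunction S (residualIntegral (continuedF Q χ) c R) ∧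
    ∀ x : ℝ, 0 < x →
      VerticalIntegrable (fun s => (x : ℂ) ^ (-s) * gammaFactor α β s) κ ∧
      VerticalIntegrable
        (fun s => (x : ℂ) ^ (-s) * gammaFactor α (fun i => (starRingEnd ℂ) (β i)) s) κ ∧
      Summable (fun n => a n * zFun α β κ (lam n * x)) ∧
      Summable (fun n => (starRingEnd ℂ) (b n) *
        zFun α (fun i => (starRingEnd ℂ) (β i)) κ (mu n / (Q ^ 2 * x))) ∧
      ∑' n, a n * zFun α β κ (lam n * x) =
        residualIntegral (continuedF Q χ) c R x +
          ω / (((x * Q) ^ δ : ℝ) : ℂ) *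
            ∑' n, (starRingEnd ℂ) (b n) *
              zFun α (fun i => (starRingEnd ℂ) (β i)) κ (mu n / (Q ^ 2 * x)) := by
  have hβ' : ∀ i, 0 ≤ ((starRingEnd ℂ) (β i)).re := fun i => by simpa using hβ i
  refine ⟨isResidualFunction_residualIntegral hFE.isCompact
    (analyticOnNhd_continuedF hQ hFE.analytic) hC, fun x hx => ?_⟩
  obtain ⟨κ', hκ', hσa, hσb, hmellin⟩ := hFE.mellinInv_eq hr hφ hψ hα hβ hQ hδ hC
  have h1 := hφ.hasSum_mul_zFun hr hα hβ hκ hκ' hσa hx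
  have h2 := hψ.star.hasSum_mul_zFun hr hα hβ' hκ (by linarith) hσb
    (x := 1 / (Q ^ 2 * x)) (by positivity)
  simp only [mul_one_div] at h2
  refine ⟨verticalIntegrable_cpow_mul_gammaFactor hr hα hβ hκ hx,
    verticalIntegrable_cpow_mul_gammaFactor hr hα hβ' hκ hx, h1.summable, h2.summable, ?_⟩
  rw [h1.tsum_eq, h2.tsum_eq, hmellin x hx]
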